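/- **Setting.** Let $\Sigma=(\mathbb Z_{\ge 0})^{\mathbb Z}$ with the product $\sigma$-algebra and the pointwise order $\preccurlyeq$. Write $[a,b]$ for the set of integers between $a$ and $b$ (also for real $a,b$). For an interval $I$ of integers, $|I|$ is its number of elements and $\eta(I)=\sum_{x\in I}\eta(x)$. The time set $\mathbb T$ is $\mathbb Z_{\ge 0}$ or $[0,\infty)$ (or any canonically ordered semiring with a floor function). An environment consists of a non-empty bounded open interval $J\subseteq\mathbb R_+$, probability measures $(\mu_\rho)_{\rho\in J}$ on $\Sigma$, and probability measures $(\mathbf P^{\eta_0})_{\eta_0\in\Sigma}$ on the paths $\eta=(\eta_t)_{t\in\mathbb T}$ in $\Sigma$, measurable in $\eta_0$. Put $\mathbf P^\rho=\int\mu_\rho(d\eta_0)\,\mathbf P^{\eta_0}$. A coupling is a joint law with the given marginals. Fix $\nu>0$ and $0\le p_\circ<p_\bullet\le 1$. The conditions are the following. * **(P.1)** Under $\mathbf P^{\eta_0}$, $\eta$ starts from $\eta_0$, and for all times $s$ and all $x\in\mathbb Z$ the conditional law of $(\eta_{s+t}(x+\cdot))_{t\ge 0}$ given $(\eta_r)_{r\le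 s}$ is $\mathbf P^{\eta_s(x+\cdot)}$. * **(P.2)** For $\rho\in J$, the law $\mathbf P^\rho$ is invariant under time shifts, and $\mu_\rho$ is invariant under the translations of $\mathbb Z$. * **(P.3)** If $\eta_0'\preccurlyeq\eta_0$, there is a coupling of $\mathbf P^{\eta_0'}$ and $\mathbf P^{\eta_0}$ such that, for all $t$, $\eta_t'\preccurlyeq\eta_t$ almost surely. If $\rho'\le\rho$ are in $J$, there is a coupling of $\mu_{\rho'}$ and $\mu_\rho$ such that $\eta'\preccurlyeq\eta$ almost surely. * **(P.4)** There is $c>0$ such that $\mathbf P^\rho(|\eta_0([0,\ell-1])-\rho\ell|\ge\varepsilon\ell)\le 2e^{-c\varepsilon^2\ell}$ for all $\rho\in J$, $\varepsilon\in(0,1)$ and integers $\ell\ge 1$. * **(C.2.1)** For all integers $t,H\ge 0$ and $k\ge 1$, and all $\eta_0,\eta_0'\in\Sigma$ with $\eta_0'(x)\le\eta_0(x)$ for $x\in[-H,H]$, there is a coupling $\mathbb Q$ of $\eta\sim\mathbf P^{\eta_0}$ and $\eta'\sim\mathbf P^{\eta_0'}$ with $$\mathbb Q\big(\forall s\in[0,t],\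 \forall x\in[-H+2\nu kt,\,H-2\nu kt]:\ \eta'_s(x)\le\eta_s(x)\big)\ \ge\ 1-20e^{-k\nu t/4}.$$ * **(C.2.2)** There are $C,C'>0$ such that the following holds for all $\rho\in J$ and $\varepsilon\in(0,1)$ with $\rho+\varepsilon\in J$, and all integers $H,t\ge 1$ with $H>4\nu t$, $\nu^8t>1$ and $\nu t^{1/4}>C\varepsilon^{-2}(1+|\log^3(\nu t)|)$. Let $\ell=\lfloor t^{1/4}\rfloor$. If $\eta_0,\eta_0'\in\Sigma$ satisfy $\eta_0(I)\ge(\rho+3\varepsilon/4)|I|$ and $\eta_0'(I)\le(\rho+\varepsilon/4)|I|$ for every non-empty interval $I\subseteq[-H,H]$ with $\lfloor\ell/2\rfloor\le|I|\le\ell$, then there is a coupling $\mathbb Q$ of $\eta\sim\mathbf P^{\eta_0}$ and $\eta'\sim\mathbf P^{\eta_0'}$ with $$\mathbb Q\big(\forall x\in[-H+4\nu t,\,H-4\nu t]:\ \eta'_t(x)\le\eta_t(x)\big)\ \ge\ 1-C'tH\exp\!\big(-(C'(1+\nu^{-1}))^{-1}\varepsilon^2t^{1/4}\big).$$ **The walk.**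 Given $\eta$, and $U_0,U_1,\dots$ independent and uniform on $[0,1]$, independent of $\eta$, let $X_0=0$ and $$X_{n+1}=X_n+2\cdot\mathbf 1\{U_n\le(p_\circ-p_\bullet)\mathbf 1\{\eta_n(X_n)=0\}+p_\bullet\}-1 .$$ For an integer $L\ge 1$, let $\mathbf P^{\rho,L}$ be the law of the environment whose restrictions to the time blocks $[kL,(k+1)L)$, $k\ge 0$, are independent and each distributed as $(\eta_s)_{0\le s<L}$ under $\mathbf P^\rho$. Let $v(\rho,L)=\mathbb E[X_L/L]$ for the walk $X$ in an environment with law $\mathbf P^{\rho,L}$. Let $v(\rho)=\lim_{L\to\infty}v(\rho,L)$ where this limit exists, and let $\bar J$ be the set of $\rho\in J$ for which it exists. **Proposition.** Let $\nu>0$ and $0\le p_\circ<p_\bullet\le 1$, and let the environment satisfy (P.1)–(P.4), (C.2.1) and (C.2.2). Then for all $\rho\in J$ and $\varepsilon>0$ with $\rho+\varepsilon\in J$, $$\limsup_{L\to\infty}v(\rho,L)\ \le\ \liminf_{L\to\infty}v(\rho+\varepsilon,L).$$ Moreover, $J\setminus\bar J$ is countable (possibly finite or empty), and $v$ is non-decreasing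 on $\bar J$. -/

import Mathlib

open MeasureTheory ProbabilityTheory Filter Topology

noncomputable section

/-- Particle configurations `Σ = (ℤ≥0)^ℤ`, with the product `σ`-algebra and the pointwise order. -/
abbrev Config : Type := ℤ → ℕ

/-- `η(I)` for the interval of integers `I = [a, b]`: the number of particles in `I`. -/
def count (η : Config) (a b : ℤ) : ℕ := ∑ x ∈ Finset.Icc a b, η x

/-- `Q` is a coupling of the laws `P` and `P'`. -/
def IsCoupling {Ω Ω' : Type*} [MeasurableSpace Ω] [MeasurableSpace Ω']
    (Q : Measure (Ω × Ω')) (P : Measure Ω) (P' : Measure Ω') : Prop :=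
  Q.map Prod.fst = P ∧ Q.map Prod.snd = P'

/-! ### The random walk -/

/-- The walk started from `0` that is driven by the environment `η` and the variables `u 0, u 1, …`:
`X₀ = 0` and `Xₙ₊₁ = Xₙ + 2 · 1{Uₙ ≤ (p∘ - p•) 1{ηₙ(Xₙ) = 0} + p•} - 1`.
It looks at the environment at integer times only. -/
def walk {T : Type*} [NatCast T] (pEmpty pOcc : ℝ) (η : T → Config) (u : ℕ → unitInterval) : ℕ → ℤ
  | 0 => 0
  | n + 1 =>
    walk pEmpty pOcc η u n +
      2 * (if (u n : ℝ) ≤ (pEmpty - pOcc) *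
            (if η (n : T) (walk pEmpty pOcc η u n) = 0 then 1 else 0) + pOcc then 1 else 0) - 1

/-- The law of a sequence of independent uniform variables on `[0, 1]`. -/
def uniformSeqLaw : Measure (ℕ → unitInterval) :=
  Measure.infinitePi fun _ : ℕ => (volume : Measure unitInterval)

instance : IsProbabilityMeasure uniformSeqLaw := by
  unfold uniformSeqLaw; infer_instance

/-- The quenched law `P^η` of the walk in the fixed environment `η`. -/
def quenchedLaw {T : Type*} [NatCast T] (pEmpty pOcc : ℝ) (η : T → Config) : Measure (ℕ → ℤ) :=
  uniformSeqLaw.map (walk pEmpty pOcc η)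

/-- The annealed law `∫ P(dη) P^η` of the walk when the environment has law `P`. -/
def annealedLaw {T : Type*} [NatCast T] (pEmpty pOcc : ℝ) (P : Measure (T → Config)) :
    Measure (ℕ → ℤ) :=
  P.bind (quenchedLaw pEmpty pOcc)

lemma measurable_walk_joint {T : Type*} [NatCast T] (pEmpty pOcc : ℝ) :
    Measurable fun q : (T → Config) × (ℕ → unitInterval) => walk pEmpty pOcc q.1 q.2 := by
  refine measurable_pi_lambda _ fun n => ?_
  induction n with
  | zero => exact measurable_const
  | succ n ih =>
    have hη : Measurable fun q : (T → Config) × (ℕ → unitInterval) =>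
        q.1 (n : T) (walk pEmpty pOcc q.1 q.2 n) := by
      have h : Measurable fun r : Config × ℤ => r.1 r.2 :=
        measurable_from_prod_countable_left fun x => measurable_pi_apply x
      exact h.comp ((((measurable_pi_apply (n : T)).comp measurable_fst)).prodMk ih)
    have hu : Measurable fun q : (T → Config) × (ℕ → unitInterval) => ((q.2 n : unitInterval) : ℝ) :=
      measurable_subtype_coe.comp ((measurable_pi_apply n).comp measurable_snd)
    have hI : Measurable fun q : (T → Config) × (ℕ → unitInterval) =>
        (pEmpty - pOcc) *
          (if q.1 (n : T) (walk pEmpty pOcc q.1 q.2 n) = 0 then (1 : ℝ) else 0) + pOcc :=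
      ((Measurable.ite (hη (measurableSet_singleton 0)) measurable_const
        measurable_const).const_mul _).add_const _
    have hJ : Measurable fun q : (T → Config) × (ℕ → unitInterval) =>
        (if (q.2 n : ℝ) ≤ (pEmpty - pOcc) *
          (if q.1 (n : T) (walk pEmpty pOcc q.1 q.2 n) = 0 then (1 : ℝ) else 0) + pOcc
          then (1 : ℤ) else 0) :=
      Measurable.ite (measurableSet_le hu hI) measurable_const measurable_const
    exact (ih.add (hJ.const_mul 2)).sub_const 1

/-- The quenched laws depend measurably on the environment, so that `annealedLaw` is the integral of
the quenched laws. -/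
lemma measurable_quenchedLaw {T : Type*} [NatCast T] (pEmpty pOcc : ℝ) :
    Measurable fun η : T → Config => quenchedLaw pEmpty pOcc η := by
  refine Measure.measurable_of_measurable_coe _ fun s hs => ?_
  have h := measurable_walk_joint (T := T) pEmpty pOcc
  have e : (fun η : T → Config => quenchedLaw pEmpty pOcc η s) =
      fun η => uniformSeqLaw (Prod.mk η ⁻¹' ((fun q : (T → Config) × (ℕ → unitInterval) =>
        walk pEmpty pOcc q.1 q.2) ⁻¹' s)) := by
    funext η
    exact Measure.map_apply (h.comp measurable_prodMk_left) hs
  rw [e]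
  exact measurable_measure_prodMk_left (h hs)

/-! ### Environments -/

/-- The data of an environment with time set `T` (such as `ℕ` or `ℝ≥0`): a non-empty bounded open
interval `J = (lo, hi)` of non-negative reals, the initial laws `μ ρ` for `ρ ∈ J` (the values of `μ`
outside of `J` are never used), and the laws `𝐏^{η₀}`, which depend measurably on the initial
configuration `η₀`. -/
structure RandomEnvironment (T : Type*) where
  lo : ℝ
  hi : ℝ
  lo_nonneg : 0 ≤ lo
  lo_lt_hi : lo < hi
  μ : ℝ → Measure Config
  prob_μ : ∀ ρ, IsProbabilityMeasure (μ ρ)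
  law : Kernel Config (T → Config)
  markov_law : IsMarkovKernel law

namespace RandomEnvironment

section basic

variable {T : Type*} (E : RandomEnvironment T)

instance (ρ : ℝ) : IsProbabilityMeasure (E.μ ρ) := E.prob_μ ρ

instance : IsMarkovKernel E.law := E.markov_law

/-- The interval `J` of densities. -/
def J : Set ℝ := Set.Ioo E.lo E.hi

/-- `𝐏^ρ = ∫ μ_ρ(dη₀) 𝐏^{η₀}`. -/
def stationaryLaw (ρ : ℝ) : Measure (T → Config) := (E.μ ρ).bind E.law

instance (ρ : ℝ) : IsProbabilityMeasure (E.stationaryLaw ρ) := by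
  unfold stationaryLaw; infer_instance

/-- The `σ`-algebra generated by `η_r`, `r ≤ s`. -/
abbrev past [LE T] (s : T) : MeasurableSpace (T → Config) :=
  MeasurableSpace.comap (fun (η : T → Config) (r : {r : T // r ≤ s}) => η r) inferInstance

end basic

section conditions

variable {T : Type*} [CommSemiring T] [LinearOrder T] (E : RandomEnvironment T)

/-- Markov property and invariance: under `𝐏^{η₀}` the process starts from `η₀` and, for all times
`s` and all `x ∈ ℤ`, the conditional law of `(η_{s+t}(x + ·))_{t ≥ 0}` given `(η_r)_{r ≤ s}` is
`𝐏^{η_s(x + ·)}`. -/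
def MarkovInvariant : Prop :=
  (∀ η₀ : Config, ∀ᵐ η ∂(E.law η₀), η 0 = η₀) ∧
  ∀ (η₀ : Config) (s : T) (x : ℤ) (A B : Set (T → Config)),
    MeasurableSet[past s] A → MeasurableSet B →
      E.law η₀ (A ∩ {η | (fun (t : T) (y : ℤ) => η (s + t) (x + y)) ∈ B}) =
        ∫⁻ η in A, E.law (fun y : ℤ => η s (x + y)) B ∂(E.law η₀)

/-- Stationarity in time of `𝐏^ρ`. -/
def Stationary : Prop :=
  ∀ ρ ∈ E.J, ∀ s : T,
    (E.stationaryLaw ρ).map (fun (η : T → Config) (t : T) => η (t + s)) = E.stationaryLaw ρ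

/-- The laws `μ_ρ` are invariant under the translations of `ℤ`. -/
def TranslationInvariant : Prop :=
  ∀ ρ ∈ E.J, ∀ x : ℤ, (E.μ ρ).map (fun (η : Config) (y : ℤ) => η (x + y)) = E.μ ρ

/-- Monotonicity, quenched and annealed. The order of the quantifiers over times and realisations is
immaterial when `T` is countable; it is the less demanding one when `T` is uncountable. -/
def Monotonicity : Prop :=
  (∀ η₀' η₀ : Config, η₀' ≤ η₀ →
    ∃ Q : Measure ((T → Config) × (T → Config)), IsCoupling Q (E.law η₀') (E.law η₀) ∧
      ∀ t : T, ∀ᵐ q ∂Q, q.1 t ≤ q.2 t) ∧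
  (∀ ρ' ∈ E.J, ∀ ρ ∈ E.J, ρ' ≤ ρ →
    ∃ Q : Measure (Config × Config), IsCoupling Q (E.μ ρ') (E.μ ρ) ∧ ∀ᵐ q ∂Q, q.1 ≤ q.2)

/-- Density at stationarity. -/
def DensityAtStationarity : Prop :=
  ∃ c : ℝ, 0 < c ∧ ∀ ρ ∈ E.J, ∀ ε ∈ Set.Ioo (0 : ℝ) 1, ∀ l : ℕ, 1 ≤ l →
    (E.stationaryLaw ρ).real {η | ε * l ≤ |(count (η 0) 0 ((l : ℤ) - 1) : ℝ) - ρ * l|} ≤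
      2 * Real.exp (-c * ε ^ 2 * l)

/-- No particle drifting in from the side, at activity rate `ν`. Here `q.1` is `η` and `q.2` is `η'`,
and `[0, t]` and `[-H + 2νkt, H - 2νkt]` are sets of integers. -/
def NoDriftFromSide (ν : ℝ) : Prop :=
  ∀ t H k : ℕ, 1 ≤ k → ∀ η₀ η₀' : Config,
    (∀ x : ℤ, -(H : ℤ) ≤ x → x ≤ H → η₀' x ≤ η₀ x) →
    ∃ Q : Measure ((T → Config) × (T → Config)), IsCoupling Q (E.law η₀) (E.law η₀') ∧
      1 - 20 * Real.exp (-(k * ν * t) / 4) ≤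
        Q.real {q | ∀ s : ℕ, s ≤ t → ∀ x : ℤ,
          -(H : ℝ) + 2 * ν * k * t ≤ x → (x : ℝ) ≤ H - 2 * ν * k * t →
            q.2 (s : T) x ≤ q.1 (s : T) x}

/-- Covering `η'` by `η`, at activity rate `ν`. Here `q.1` is `η` and `q.2` is `η'`, and `[a, b]` is
an interval of integers, of length `b - a + 1`. -/
def Covering (ν : ℝ) : Prop :=
  ∃ C C' : ℝ, 0 < C ∧ 0 < C' ∧
    ∀ ρ ∈ E.J, ∀ ε ∈ Set.Ioo (0 : ℝ) 1, ρ + ε ∈ E.J →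
    ∀ H t : ℕ, 1 ≤ H → 1 ≤ t →
    4 * ν * t < H → 1 < ν ^ 8 * t →
    C * ε⁻¹ ^ 2 * (1 + |Real.log (ν * t) ^ 3|) < ν * (t : ℝ) ^ (1 / 4 : ℝ) →
    ∀ l : ℕ, l = ⌊(t : ℝ) ^ (1 / 4 : ℝ)⌋₊ →
    ∀ η₀ η₀' : Config,
    (∀ a b : ℤ, -(H : ℤ) ≤ a → a ≤ b → b ≤ H →
      ((l / 2 : ℕ) : ℤ) ≤ b - a + 1 → b - a + 1 ≤ (l : ℤ) →
        (ρ + 3 * ε / 4) * ((b - a + 1 : ℤ) : ℝ) ≤ (count η₀ a b : ℝ) ∧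
        (count η₀' a b : ℝ) ≤ (ρ + ε / 4) * ((b - a + 1 : ℤ) : ℝ)) →
    ∃ Q : Measure ((T → Config) × (T → Config)), IsCoupling Q (E.law η₀) (E.law η₀') ∧
      1 - C' * t * H * Real.exp (-(C' * (1 + ν⁻¹))⁻¹ * ε ^ 2 * (t : ℝ) ^ (1 / 4 : ℝ)) ≤
        Q.real {q | ∀ x : ℤ, -(H : ℝ) + 4 * ν * t ≤ x → (x : ℝ) ≤ H - 4 * ν * t →
          q.2 (t : T) x ≤ q.1 (t : T) x}

end conditions

section speed

variable {T : Type*} [CommSemiring T] [LinearOrder T] [Sub T] [FloorSemiring T]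
  (E : RandomEnvironment T)

/-- The law `𝐏^{ρ,L}` of the environment of range `L`, for `L ≥ 1`: the environments on the time
blocks `[kL, (k + 1)L)` are independent, and each is distributed as `(η_s)_{0 ≤ s < L}` under `𝐏^ρ`;
in particular the configuration is sampled afresh from `μ_ρ` at every multiple of `L`. -/
def finiteRangeLaw (ρ : ℝ) (L : ℕ) : Measure (T → Config) :=
  (Measure.infinitePi fun _ : ℕ => E.stationaryLaw ρ).map
    fun (ω : ℕ → T → Config) (t : T) => ω (⌊t⌋₊ / L) (t - ((⌊t⌋₊ / L * L : ℕ) : T))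

/-- `v(ρ, L) = 𝔼^{ρ,L}[X_L / L]`, the speed of the walk in the environment of range `L`. -/
def rangeSpeed (pEmpty pOcc ρ : ℝ) (L : ℕ) : ℝ :=
  ∫ X : ℕ → ℤ, (X L : ℝ) / L ∂(annealedLaw pEmpty pOcc (E.finiteRangeLaw ρ L))

/-- The set of the densities `ρ ∈ J` at which `v(ρ) = lim_L v(ρ, L)` exists. -/
def Jbar (pEmpty pOcc : ℝ) : Set ℝ :=
  {ρ | ρ ∈ E.J ∧ ∃ w : ℝ, Tendsto (fun L : ℕ => E.rangeSpeed pEmpty pOcc ρ L) atTop (𝓝 w)}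

/-- `v(ρ) = lim_L v(ρ, L)`, which is meaningful for `ρ` in `Jbar`. -/
def speed (pEmpty pOcc ρ : ℝ) : ℝ :=
  limUnder atTop fun L : ℕ => E.rangeSpeed pEmpty pOcc ρ L

end speed

end RandomEnvironment

end

/-!
The walk is monotone in its environment, so `v(ρ, L)` is compared with `v(ρ + δ, M)`, for `M`
between `L²` and `L⁴` and `δ ≥ L^(-1/32)`, by cutting `[0, M)` into blocks of length `t + L` with
`t ≈ √L`. With a small probability of failure, even summed over all the blocks, the environment of
density `ρ + δ` is typical at the start of every block, and so is an independent sample of density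
`ρ`. Covering then lets the denser environment dominate the sparser one, within reach of the walk,
after the first `t` steps; these cost at most a displacement of order `t`, and during the next `L`
steps no drift from the side spoils the domination. Hence `v(ρ, L) ≤ v(ρ + δ, M) + L^(-1/32)`.

Iterating along `L, L², L⁴, …` keeps both the total increase of density and the total error of order
`L^(-1/32)`, and so `limsup v(ρ, ·) ≤ liminf v(ρ', ·)` whenever `ρ < ρ'`. The open intervals between
the lower and the upper limits at different densities are therefore disjoint, and only countably
many of them are non-empty.
-/

/-! ### Iteration over the scales -/

section scales

/-- The values of `v` at the scale `L` are dominated, up to the error `L ^ (-1 / 32)`, by those at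
the scales in `[L ^ 2, L ^ 4]` and at parameters larger by at least the same amount. -/
def ComparableAtScale (v : ℝ → ℕ → ℝ) (J : Set ℝ) (L : ℕ) : Prop :=
  ∀ δ : ℝ, (L : ℝ) ^ (-(1 / 32) : ℝ) ≤ δ → δ < 1 → ∀ ρ ∈ J, ρ + δ ∈ J →
    ∀ M : ℕ, L ^ 2 ≤ M → M ≤ L ^ 4 → v ρ L ≤ v (ρ + δ) M + (L : ℝ) ^ (-(1 / 32) : ℝ)

variable {v : ℝ → ℕ → ℝ} {J : Set ℝ}

lemma tendsto_natCast_rpow_neg {y : ℝ} (hy : 0 < y) :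
    Tendsto (fun L : ℕ => (L : ℝ) ^ (-y)) atTop (𝓝 0) :=
  (tendsto_rpow_neg_atTop hy).comp tendsto_natCast_atTop_atTop

/-- The comparison is iterated along `L, L ^ 2, L ^ 4, …`: if `s = L ^ (-1 / 32)`, the increments of
the parameter sum up to `s + s ^ 2 + s ^ 4 + ⋯ ≤ 3 * s`. -/
lemma ComparableAtScale.eventually_forall_le (hJ : J.OrdConnected)
    (h : ∀ᶠ L in atTop, ComparableAtScale v J L) :
    ∀ᶠ L : ℕ in atTop, ∀ M : ℕ, L ^ 2 ≤ M → ∀ δ : ℝ, 3 * (L : ℝ) ^ (-(1 / 32) : ℝ) ≤ δ → δ < 1 →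
      ∀ ρ ∈ J, ρ + δ ∈ J → v ρ L ≤ v (ρ + δ) M + 3 * (L : ℝ) ^ (-(1 / 32) : ℝ) := by
  have hsmall := (tendsto_natCast_rpow_neg (y := 1 / 32) (by norm_num)).eventually
    (gt_mem_nhds (show (0 : ℝ) < 2 / 3 by norm_num))
  obtain ⟨L₀, hL₀⟩ := eventually_atTop.1 ((h.and hsmall).and (eventually_ge_atTop 2))
  refine eventually_atTop.2 ⟨L₀, fun L hL M hLM => ?_⟩
  generalize hd : M - L = d
  induction d using Nat.strong_induction_on generalizing L with
  | _ d ih =>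
    intro δ hδ hδ1 ρ hρ hρ'
    obtain ⟨⟨hcomp, hs⟩, hL2⟩ := hL₀ L hL
    have Lpos : (0 : ℝ) < L := by exact_mod_cast (by omega : 0 < L)
    have hsq : ((L ^ 2 : ℕ) : ℝ) ^ (-(1 / 32) : ℝ) = ((L : ℝ) ^ (-(1 / 32) : ℝ)) ^ 2 := by
      rw [Nat.cast_pow, Real.rpow_pow_comm Lpos.le]
    set s := (L : ℝ) ^ (-(1 / 32) : ℝ)
    have spos : 0 < s := Real.rpow_pos_of_pos Lpos _
    by_cases hM4 : M ≤ L ^ 4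
    · linarith [hcomp δ (by linarith) hδ1 ρ hρ hρ' M hLM hM4]
    have hlt : L < L ^ 2 := by nlinarith
    have hmid : ρ + s ∈ J := hJ.out hρ hρ' ⟨by linarith, by linarith⟩
    have hnext := hcomp s le_rfl (by linarith) ρ hρ hmid (L ^ 2) le_rfl
      (Nat.pow_le_pow_right (by omega) (by norm_num))
    have hrest := ih (M - L ^ 2) (by omega) (L ^ 2) (by omega)
      (by rw [← pow_mul]; exact (not_le.1 hM4).le) rfl (δ - s) (by rw [hsq]; nlinarith)
      (by linarith) (ρ + s) hmid (by rwa [add_add_sub_cancel])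
    rw [hsq, add_add_sub_cancel] at hrest
    nlinarith

lemma limsup_le_liminf_of_eventually_le {u u' e : ℕ → ℝ} (hu : IsBoundedUnder (· ≥ ·) atTop u)
    (hu' : IsBoundedUnder (· ≤ ·) atTop u') (he : Tendsto e atTop (𝓝 0))
    (h : ∀ᶠ L in atTop, ∀ᶠ M in atTop, u L ≤ u' M + e L) :
    limsup u atTop ≤ liminf u' atTop := by
  have hlim : Tendsto (fun L => liminf u' atTop + e L) atTop (𝓝 (liminf u' atTop)) := by
    simpa using he.const_add (liminf u' atTop)
  rw [← hlim.limsup_eq]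
  refine limsup_le_limsup ?_ hu.isCoboundedUnder_le hlim.isBoundedUnder_le
  filter_upwards [h] with L hL
  rw [← sub_le_iff_le_add]
  exact le_liminf_of_le hu'.isCoboundedUnder_ge (hL.mono fun M hM => sub_le_iff_le_add.2 hM)

lemma ComparableAtScale.limsup_le_liminf (hJ : J.OrdConnected)
    (hb : ∀ ρ, IsBoundedUnder (· ≤ ·) atTop (v ρ)) (hb' : ∀ ρ, IsBoundedUnder (· ≥ ·) atTop (v ρ))
    (h : ∀ᶠ L in atTop, ComparableAtScale v J L)
    {ρ ρ' : ℝ} (hρ : ρ ∈ J) (hρ' : ρ' ∈ J) (hlt : ρ < ρ') :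
    limsup (v ρ) atTop ≤ liminf (v ρ') atTop := by
  obtain ⟨n, hn⟩ := pow_unbounded_of_one_lt (ρ' - ρ) one_lt_two
  induction n generalizing ρ ρ' with
  | zero =>
    have hlim : Tendsto (fun L : ℕ => 3 * (L : ℝ) ^ (-(1 / 32) : ℝ)) atTop (𝓝 0) := by
      simpa using (tendsto_natCast_rpow_neg (y := 1 / 32) (by norm_num)).const_mul 3
    refine limsup_le_liminf_of_eventually_le (hb' ρ) (hb ρ') hlim ?_
    filter_upwards [ComparableAtScale.eventually_forall_le hJ h,
      hlim.eventually (gt_mem_nhds (sub_pos.2 hlt))] with L hL hsmall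
    filter_upwards [eventually_ge_atTop (L ^ 2)] with M hM
    simpa using hL M hM (ρ' - ρ) hsmall.le (by simpa using hn) ρ hρ (by simpa using hρ')
  | succ n ih =>
    rw [pow_succ] at hn
    have hmid : (ρ + ρ') / 2 ∈ J := hJ.out hρ hρ' ⟨by linarith, by linarith⟩
    exact (ih hρ hmid (by linarith) (by linarith)).trans
      ((liminf_le_limsup (hb _) (hb' _)).trans (ih hmid hρ' (by linarith) (by linarith)))

end scales

/-! ### Families ordered by their upper and lower limits -/

section interlacing

variable {ι α : Type*} [LinearOrder ι] {l : Filter α} [l.NeBot] {v : ι → α → ℝ} {J : Set ι}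

lemma countable_diff_tendsto (hb : ∀ i, l.IsBoundedUnder (· ≤ ·) (v i))
    (hb' : ∀ i, l.IsBoundedUnder (· ≥ ·) (v i))
    (h : ∀ i ∈ J, ∀ j ∈ J, i < j → limsup (v i) l ≤ liminf (v j) l) :
    (J \ {i | i ∈ J ∧ ∃ w, Tendsto (v i) l (𝓝 w)}).Countable := by
  set gap : ι → Set ℝ := fun i => Set.Ioo (liminf (v i) l) (limsup (v i) l)
  have hlt : ∀ i ∈ J, ∀ j ∈ J, i < j → Disjoint (gap i) (gap j) := fun i hi j hj hij =>
    Set.disjoint_left.2 fun _ hx hx' => (hx.2.trans_le (h i hi j hj hij)).not_gt hx'.1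
  have hdisj : (J \ {i | i ∈ J ∧ ∃ w, Tendsto (v i) l (𝓝 w)}).PairwiseDisjoint gap :=
    fun i hi j hj hne => hne.lt_or_gt.elim (hlt i hi.1 j hj.1) fun hji =>
      (hlt j hj.1 i hi.1 hji).symm
  refine hdisj.countable_of_isOpen (fun _ _ => isOpen_Ioo) fun i hi => Set.nonempty_Ioo.2 ?_
  refine (liminf_le_limsup (hb i) (hb' i)).lt_of_ne fun heq => hi.2 ⟨hi.1, limsup (v i) l, ?_⟩
  exact tendsto_of_liminf_eq_limsup heq rfl (hb i) (hb' i)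

lemma monotoneOn_limUnder (h : ∀ i ∈ J, ∀ j ∈ J, i < j → limsup (v i) l ≤ liminf (v j) l) :
    MonotoneOn (fun i => limUnder l (v i)) {i | i ∈ J ∧ ∃ w, Tendsto (v i) l (𝓝 w)} := by
  rintro i ⟨hi, a, ha⟩ j ⟨hj, b, hb⟩ hij
  rcases hij.eq_or_lt with rfl | hlt
  · exact le_rfl
  · simpa only [ha.limUnder_eq, hb.limUnder_eq, ha.limsup_eq, hb.liminf_eq] using h i hi j hj hlt

end interlacing

/-! ### Nearest-neighbour walks in a field of jump probabilities -/

/-- The transition operator of one step of a nearest-neighbour walk on `ℤ` that jumps to the right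
with probability `p x` from `x`. -/
noncomputable def stepMean (p : ℤ → unitInterval) : (ℤ → ℝ) →ₗ[ℝ] (ℤ → ℝ) where
  toFun f x := p x * f (x + 1) + (1 - p x) * f (x - 1)
  map_add' f g := by ext x; simp only [Pi.add_apply]; ring
  map_smul' c f := by ext x; simp only [Pi.smul_apply, smul_eq_mul, RingHom.id_apply]; ring

/-- `walkMean w n f y` is the mean of `f (Xₙ)` for the nearest-neighbour walk started from `X₀ = y`
whose step number `k` jumps to the right with probability `w k x` from `x`. -/
noncomputable def walkMean (w : ℕ → ℤ → unitInterval) : ℕ → (ℤ → ℝ) →ₗ[ℝ] (ℤ → ℝ)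
  | 0 => LinearMap.id
  | n + 1 => walkMean w n ∘ₗ stepMean (w n)

lemma stepMean_apply (p : ℤ → unitInterval) (f : ℤ → ℝ) (x : ℤ) :
    stepMean p f x = p x * f (x + 1) + (1 - p x) * f (x - 1) := rfl

lemma stepMean_mem_segment (p : ℤ → unitInterval) (f : ℤ → ℝ) (x : ℤ) :
    stepMean p f x ∈ segment ℝ (f (x - 1)) (f (x + 1)) :=
  ⟨1 - p x, p x, unitInterval.one_minus_nonneg _, (p x).2.1, by ring,
    by simp only [stepMean_apply, smul_eq_mul]; ring⟩

lemma stepMean_le_stepMean (p : ℤ → unitInterval) {f g : ℤ → ℝ} {x : ℤ}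
    (hl : f (x - 1) ≤ g (x - 1)) (hr : f (x + 1) ≤ g (x + 1)) :
    stepMean p f x ≤ stepMean p g x :=
  add_le_add (mul_le_mul_of_nonneg_left hr (p x).2.1)
    (mul_le_mul_of_nonneg_left hl (unitInterval.one_minus_nonneg _))

lemma stepMean_mono_left {p' p : ℤ → unitInterval} {f : ℤ → ℝ} {x : ℤ} (hp : p' x ≤ p x)
    (hf : f (x - 1) ≤ f (x + 1)) : stepMean p' f x ≤ stepMean p f x := by
  have h := mul_le_mul_of_nonneg_right (Subtype.coe_le_coe.2 hp) (sub_nonneg.2 hf)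
  simp only [stepMean_apply]
  linarith

@[simp] lemma walkMean_zero (w : ℕ → ℤ → unitInterval) (f : ℤ → ℝ) : walkMean w 0 f = f := rfl

lemma walkMean_succ (w : ℕ → ℤ → unitInterval) (n : ℕ) (f : ℤ → ℝ) :
    walkMean w (n + 1) f = walkMean w n (stepMean (w n) f) := rfl

lemma walkMean_add (w : ℕ → ℤ → unitInterval) (n m : ℕ) (f : ℤ → ℝ) :
    walkMean w (n + m) f = walkMean w n (walkMean (fun k => w (n + k)) m f) := by
  induction m generalizing f with
  | zero => rfl
  | succ m ih => rw [← add_assoc, walkMean_succ, ih, walkMean_succ]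

lemma walkMean_const (w : ℕ → ℤ → unitInterval) (n : ℕ) (c : ℝ) :
    walkMean w n (fun _ => c) = fun _ => c := by
  induction n with
  | zero => rfl
  | succ n ih =>
    have h : stepMean (w n) (fun _ => c) = fun _ => c := by ext x; rw [stepMean_apply]; ring
    rw [walkMean_succ, h, ih]

lemma walkMean_translate (w : ℕ → ℤ → unitInterval) (n : ℕ) (f : ℤ → ℝ) (x y : ℤ) :
    walkMean w n f (x + y) = walkMean (fun k z => w k (x + z)) n (fun z => f (x + z)) y := by
  induction n generalizing f with
  | zero => rfl
  | succ n ih =>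
    rw [walkMean_succ, walkMean_succ, ih]
    refine congrFun (congrArg _ (funext fun z => ?_)) y
    simp only [stepMean_apply, add_assoc, add_sub_assoc]

lemma walkMean_congr_field {w w' : ℕ → ℤ → unitInterval} {n : ℕ} (h : ∀ k < n, w k = w' k) :
    walkMean w n = walkMean w' n := by
  induction n with
  | zero => rfl
  | succ n ih => rw [walkMean, walkMean, ih fun k hk => h k (by omega), h n n.lt_succ_self]

lemma walkMean_le_walkMean (w : ℕ → ℤ → unitInterval) {n : ℕ} {f g : ℤ → ℝ} {y : ℤ}
    (h : ∀ x, |x - y| ≤ n → f x ≤ g x) : walkMean w n f y ≤ walkMean w n g y := by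
  induction n generalizing f g with
  | zero => exact h y (by simp)
  | succ n ih =>
    refine ih fun x hx => stepMean_le_stepMean _ (h _ ?_) (h _ ?_) <;>
    · rw [abs_le] at *
      push_cast
      omega

lemma walkMean_congr (w : ℕ → ℤ → unitInterval) {n : ℕ} {f g : ℤ → ℝ} {y : ℤ}
    (h : ∀ x, |x - y| ≤ n → f x = g x) : walkMean w n f y = walkMean w n g y :=
  le_antisymm (walkMean_le_walkMean w fun x hx => (h x hx).le)
    (walkMean_le_walkMean w fun x hx => (h x hx).ge)

lemma walkMean_mem_Icc (w : ℕ → ℤ → unitInterval) {n : ℕ} {f : ℤ → ℝ} {y : ℤ} {a b : ℝ}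
    (h : ∀ x, |x - y| ≤ n → f x ∈ Set.Icc a b) : walkMean w n f y ∈ Set.Icc a b := by
  constructor
  · simpa only [walkMean_const] using
      walkMean_le_walkMean w (f := fun _ => a) fun x hx => (h x hx).1
  · simpa only [walkMean_const] using
      walkMean_le_walkMean w (g := fun _ => b) fun x hx => (h x hx).2

lemma walkMean_eq_sum (w : ℕ → ℤ → unitInterval) (n : ℕ) (f : ℤ → ℝ) :
    walkMean w n f 0 =
      ∑ x ∈ Finset.Icc (-(n : ℤ)) n, walkMean w n (Pi.single x 1) 0 * f x := by
  have h : walkMean w n f 0 =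
      walkMean w n (∑ x ∈ Finset.Icc (-(n : ℤ)) n, f x • Pi.single x 1) 0 := by
    refine walkMean_congr w fun y hy => ?_
    rw [sub_zero, abs_le, ← Finset.mem_Icc] at hy
    simp [Finset.sum_apply, Pi.single_apply, hy]
  rw [h, map_sum, Finset.sum_apply]
  simp only [map_smul, Pi.smul_apply, smul_eq_mul, mul_comm]

lemma measurable_walkMean {Ω : Type*} [MeasurableSpace Ω] {w : Ω → ℕ → ℤ → unitInterval}
    {f : Ω → ℤ → ℝ} {n : ℕ} (hw : ∀ k < n, ∀ x, Measurable fun ω => w ω k x)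
    (hf : ∀ x, Measurable fun ω => f ω x) (y : ℤ) :
    Measurable fun ω => walkMean (w ω) n (f ω) y := by
  induction n generalizing f with
  | zero => exact hf y
  | succ n ih =>
    refine ih (fun k hk => hw k (by omega)) fun x => ?_
    have hwx : Measurable fun ω => (w ω n x : ℝ) := (hw n n.lt_succ_self x).subtype_val
    exact (hwx.mul (hf _)).add ((hwx.const_sub 1).mul (hf _))

/- The walk only visits one parity class at each time, so that monotonicity along each class is what
the transition operators preserve. -/
lemma walkMean_le_walkMean_add_two (w : ℕ → ℤ → unitInterval) (n : ℕ) {f : ℤ → ℝ}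
    (hf : ∀ x, f x ≤ f (x + 2)) (x : ℤ) : walkMean w n f x ≤ walkMean w n f (x + 2) := by
  induction n generalizing f with
  | zero => exact hf x
  | succ n ih =>
    refine ih fun z => ?_
    have hz : f (z - 1) ≤ f (z + 1) := by simpa [sub_add] using hf (z - 1)
    have hz' : f (z + 2 - 1) ≤ f (z + 2 + 1) := by simpa [sub_add] using hf (z + 2 - 1)
    calc stepMean (w n) f z ≤ f (z + 1) := by
          simpa using (segment_subset_Icc hz (stepMean_mem_segment (w n) f z)).2
      _ = f (z + 2 - 1) := by congr 1; ring
      _ ≤ stepMean (w n) f (z + 2) :=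
        (segment_subset_Icc hz' (stepMean_mem_segment (w n) f (z + 2))).1

lemma walkMean_mono_field {w' w : ℕ → ℤ → unitInterval} {n : ℕ} {f : ℤ → ℝ}
    (hf : ∀ x, f x ≤ f (x + 2)) {y : ℤ} (hw : ∀ k < n, ∀ x, |x - y| ≤ n → w' k x ≤ w k x) :
    walkMean w' n f y ≤ walkMean w n f y := by
  induction n generalizing f with
  | zero => exact le_rfl
  | succ n ih =>
    have hstep : ∀ x, stepMean (w' n) f x ≤ stepMean (w' n) f (x + 2) :=
      walkMean_le_walkMean_add_two (fun _ => w' n) 1 hf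
    calc walkMean w' n (stepMean (w' n) f) y
        ≤ walkMean w n (stepMean (w' n) f) y :=
          ih hstep fun k hk x hx => hw k (by omega) x (hx.trans (by push_cast; omega))
      _ ≤ walkMean w n (stepMean (w n) f) y := by
          refine walkMean_le_walkMean w fun x hx => stepMean_mono_left ?_ ?_
          · exact hw n n.lt_succ_self x (hx.trans (by push_cast; omega))
          · simpa [sub_add] using hf (x - 1)

lemma apply_sub_le_walkMean (w : ℕ → ℤ → unitInterval) (n : ℕ) {f : ℤ → ℝ}
    (hf : ∀ x, f x ≤ f (x + 2)) (y : ℤ) : f (y - n) ≤ walkMean w n f y := by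
  have hleft : walkMean 0 n f y = f (y - n) := by
    clear hf
    induction n generalizing f with
    | zero => simp
    | succ n ih =>
      rw [walkMean_succ, ih]
      simp [stepMean_apply, sub_sub]
  rw [← hleft]
  exact walkMean_mono_field hf fun k _ x _ => unitInterval.nonneg'

/-! ### The walk in an environment -/

/-- The probability of a jump to the right from a site with `k` particles: the probability that a
uniform variable on `[0, 1]` is at most `pEmpty` or `pOcc`, whence the clamping. -/
noncomputable def jumpProb (pEmpty pOcc : ℝ) (k : ℕ) : unitInterval :=
  Set.projIcc 0 1 zero_le_one (if k = 0 then pEmpty else pOcc)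

lemma jumpProb_mono {pEmpty pOcc : ℝ} (h : pEmpty ≤ pOcc) : Monotone (jumpProb pEmpty pOcc) := by
  refine (Set.monotone_projIcc zero_le_one).comp fun k l hkl => ?_
  split_ifs with hk hl <;> first | exact le_rfl | exact h | omega

section quenched

variable {T : Type*} [NatCast T] (pEmpty pOcc : ℝ)

/-- The field of the jump probabilities at integer times in the environment `η`. -/
noncomputable def jumpField (η : T → Config) (n : ℕ) (x : ℤ) : unitInterval :=
  jumpProb pEmpty pOcc (η n x)

/-- `E^η[Xₙ]`, the quenched mean of the walk in the environment `η`. -/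
noncomputable def quenchedMean (n : ℕ) (η : T → Config) : ℝ :=
  walkMean (jumpField pEmpty pOcc η) n Int.cast 0

/-- `P^η(Xₙ = x)`, the quenched distribution of the walk in the environment `η`. -/
noncomputable def quenchedProb (n : ℕ) (x : ℤ) (η : T → Config) : ℝ :=
  walkMean (jumpField pEmpty pOcc η) n (Pi.single x 1) 0

variable {pEmpty pOcc}

lemma measurable_jumpField_apply {Ω : Type*} [MeasurableSpace Ω] {g : Ω → T → Config} {n : ℕ}
    (hg : Measurable fun ω => g ω n) (x : ℤ) :
    Measurable fun ω => jumpField pEmpty pOcc (g ω) n x :=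
  (measurable_of_countable (jumpProb pEmpty pOcc)).comp ((measurable_pi_apply x).comp hg)

lemma measurable_quenchedMean (n : ℕ) :
    Measurable (quenchedMean pEmpty pOcc n : (T → Config) → ℝ) :=
  measurable_walkMean (w := jumpField pEmpty pOcc) (f := fun _ => Int.cast)
    (fun k _ => measurable_jumpField_apply (g := id) (measurable_pi_apply (k : T)))
    (fun _ => measurable_const) 0

lemma abs_quenchedMean_le (n : ℕ) (η : T → Config) : |quenchedMean pEmpty pOcc n η| ≤ n := by
  refine abs_le.2 (walkMean_mem_Icc _ fun x hx => ?_)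
  rw [sub_zero, abs_le] at hx
  exact ⟨by exact_mod_cast hx.1, by exact_mod_cast hx.2⟩

lemma quenchedProb_mem_Icc (n : ℕ) (x : ℤ) (η : T → Config) :
    quenchedProb pEmpty pOcc n x η ∈ Set.Icc (0 : ℝ) 1 :=
  walkMean_mem_Icc _ fun z _ => by
    rw [Pi.single_apply]
    split_ifs <;> simp

lemma quenchedMean_congr {n : ℕ} {η η' : T → Config} (h : ∀ k < n, η k = η' k) :
    quenchedMean pEmpty pOcc n η = quenchedMean pEmpty pOcc n η' := by
  unfold quenchedMean
  rw [walkMean_congr_field fun k hk => ?_]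
  simp only [funext_iff, jumpField, h k hk, implies_true]

lemma quenchedMean_mono (hp : pEmpty ≤ pOcc) {n : ℕ} {η' η : T → Config}
    (h : ∀ k < n, ∀ x : ℤ, |x| ≤ n → η' k x ≤ η k x) :
    quenchedMean pEmpty pOcc n η' ≤ quenchedMean pEmpty pOcc n η :=
  walkMean_mono_field (fun x => by norm_num) fun k hk x hx =>
    jumpProb_mono hp (h k hk x (by simpa using hx))

lemma sum_quenchedProb (n : ℕ) (η : T → Config) :
    ∑ x ∈ Finset.Icc (-(n : ℤ)) n, quenchedProb pEmpty pOcc n x η = 1 := by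
  have h := walkMean_eq_sum (jumpField pEmpty pOcc η) n fun _ => 1
  simp only [walkMean_const, mul_one] at h
  exact h.symm

lemma sum_quenchedProb_mul (n : ℕ) (η : T → Config) :
    ∑ x ∈ Finset.Icc (-(n : ℤ)) n, quenchedProb pEmpty pOcc n x η * x =
      quenchedMean pEmpty pOcc n η :=
  (walkMean_eq_sum (jumpField pEmpty pOcc η) n Int.cast).symm

lemma walk_succ_eq (η : T → Config) (u : ℕ → unitInterval) (n : ℕ) :
    walk pEmpty pOcc η u (n + 1) =
      if (u n : ℝ) ≤ (if η n (walk pEmpty pOcc η u n) = 0 then pEmpty else pOcc)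
        then walk pEmpty pOcc η u n + 1 else walk pEmpty pOcc η u n - 1 := by
  have hthreshold : (pEmpty - pOcc) * (if η (n : T) (walk pEmpty pOcc η u n) = 0 then 1 else 0)
      + pOcc = if η n (walk pEmpty pOcc η u n) = 0 then pEmpty else pOcc := by
    split_ifs <;> ring
  rw [walk, hthreshold]
  split_ifs <;> ring

lemma walk_congr {n : ℕ} {u v : ℕ → unitInterval} (η : T → Config) (h : ∀ k < n, u k = v k) :
    walk pEmpty pOcc η u n = walk pEmpty pOcc η v n := by
  induction n with
  | zero => rfl
  | succ n ih => rw [walk_succ_eq, walk_succ_eq, ih fun k hk => h k (by omega), h n (by omega)]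

lemma abs_walk_le (η : T → Config) (u : ℕ → unitInterval) (n : ℕ) :
    |walk pEmpty pOcc η u n| ≤ n := by
  induction n with
  | zero => simp [walk]
  | succ n ih =>
    rw [walk_succ_eq]
    rw [abs_le] at *
    push_cast
    split_ifs <;> omega

lemma measurable_walk (η : T → Config) : Measurable (walk pEmpty pOcc η) :=
  (measurable_walk_joint pEmpty pOcc).comp measurable_prodMk_left

lemma indepFun_walk_next (η : T → Config) (n : ℕ) :
    IndepFun (fun u => walk pEmpty pOcc η u n) (fun u : ℕ → unitInterval => u n)
      uniformSeqLaw := by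
  have hind : iIndepFun (fun (i : ℕ) (u : ℕ → unitInterval) => u i) uniformSeqLaw :=
    iIndepFun_infinitePi (X := fun _ x => x) (by fun_prop)
  have h := hind.indepFun_finset (Finset.range n) {n} (by simp) measurable_pi_apply
  have hpast : Measurable fun v : Finset.range n → unitInterval =>
      walk pEmpty pOcc η (fun k => if hk : k ∈ Finset.range n then v ⟨k, hk⟩ else 0) n := by
    refine (measurable_pi_apply n).comp ((measurable_walk η).comp
      (measurable_pi_lambda _ fun k => ?_))
    split_ifs
    · exact measurable_pi_apply _
    · exact measurable_const
  have hnext : Measurable fun v : ({n} : Finset ℕ) → unitInterval => v ⟨n, by simp⟩ :=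
    measurable_pi_apply _
  refine (h.comp hpast hnext).congr (.of_forall fun u => ?_) (.of_forall fun _ => rfl)
  exact walk_congr η fun k hk => by simp [hk]

lemma volume_real_unitInterval_le (q : ℝ) :
    volume.real {v : unitInterval | (v : ℝ) ≤ q} = Set.projIcc (0 : ℝ) 1 zero_le_one q := by
  rcases lt_or_ge q 0 with hq | hq
  · have h : {v : unitInterval | (v : ℝ) ≤ q} = ∅ :=
      Set.eq_empty_of_forall_notMem fun v hv => (hv.trans_lt hq).not_ge v.2.1
    simp [h, Set.projIcc_of_le_left zero_le_one hq.le]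
  · have h : {v : unitInterval | (v : ℝ) ≤ q} = Set.Iic (Set.projIcc 0 1 zero_le_one q) := by
      ext v
      simp [← Subtype.coe_le_coe, Set.coe_projIcc, v.2.2, hq]
    rw [h, measureReal_def, unitInterval.volume_Iic,
      ENNReal.toReal_ofReal (Set.projIcc 0 1 zero_le_one q).2.1]

lemma integral_unitInterval_ite_le (q a b : ℝ) :
    ∫ v : unitInterval, (if (v : ℝ) ≤ q then a else b) =
      Set.projIcc (0 : ℝ) 1 zero_le_one q * a + (1 - Set.projIcc (0 : ℝ) 1 zero_le_one q) * b := by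
  have hs : MeasurableSet {v : unitInterval | (v : ℝ) ≤ q} :=
    measurableSet_le measurable_subtype_coe measurable_const
  have h : (fun v : unitInterval => if (v : ℝ) ≤ q then a else b) =
      fun v => {v : unitInterval | (v : ℝ) ≤ q}.indicator (fun _ => a - b) v + b := by
    funext v
    by_cases hv : (v : ℝ) ≤ q <;> simp [hv]
  rw [h, integral_add ((integrable_const _).indicator hs) (integrable_const _),
    integral_indicator_const _ hs, volume_real_unitInterval_le]
  simp only [integral_const, probReal_univ, smul_eq_mul, one_mul]
  ring

lemma integrable_comp_walk (η : T → Config) (n : ℕ) (f : ℤ → ℝ) :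
    Integrable (fun u => f (walk pEmpty pOcc η u n)) uniformSeqLaw := by
  refine Integrable.of_bound ((measurable_of_countable f).comp
    ((measurable_pi_apply n).comp (measurable_walk η))).aestronglyMeasurable
    (∑ x ∈ Finset.Icc (-(n : ℤ)) n, |f x|) (.of_forall fun u => ?_)
  exact Finset.single_le_sum (f := fun x => |f x|) (fun _ _ => abs_nonneg _)
    (Finset.mem_Icc.2 (abs_le.1 (abs_walk_le η u n)))

lemma map_walk_prodMk (η : T → Config) (n : ℕ) :
    uniformSeqLaw.map (fun u => (walk pEmpty pOcc η u n, u n)) =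
      (uniformSeqLaw.map fun u => walk pEmpty pOcc η u n).prod volume := by
  have hX : Measurable fun u => walk pEmpty pOcc η u n :=
    (measurable_pi_apply n).comp (measurable_walk η)
  have hU : Measurable fun u : ℕ → unitInterval => u n := measurable_pi_apply n
  rw [(indepFun_iff_map_prod_eq_prod_map_map hX.aemeasurable hU.aemeasurable).1
    (indepFun_walk_next η n)]
  congr 1
  exact Measure.infinitePi_map_eval (fun _ : ℕ => (volume : Measure unitInterval)) n

lemma integral_comp_walk_succ (η : T → Config) (n : ℕ) (f : ℤ → ℝ) :
    ∫ u, f (walk pEmpty pOcc η u (n + 1)) ∂uniformSeqLaw =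
      ∫ u, stepMean (jumpField pEmpty pOcc η n) f (walk pEmpty pOcc η u n) ∂uniformSeqLaw := by
  have hX : Measurable fun u => walk pEmpty pOcc η u n :=
    (measurable_pi_apply n).comp (measurable_walk η)
  have hXU : Measurable fun u => (walk pEmpty pOcc η u n, u n) := hX.prodMk (measurable_pi_apply n)
  let q : ℤ → ℝ := fun x => if η n x = 0 then pEmpty else pOcc
  let F : ℤ × unitInterval → ℝ := fun r => if (r.2 : ℝ) ≤ q r.1 then f (r.1 + 1) else f (r.1 - 1)
  have hF : Measurable F := by
    have hq : Measurable q := measurable_of_countable q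
    have hf : Measurable f := measurable_of_countable f
    exact Measurable.ite (measurableSet_le (by fun_prop) (hq.comp measurable_fst))
      (by fun_prop) (by fun_prop)
  have hsucc : ∀ u, f (walk pEmpty pOcc η u (n + 1)) = F (walk pEmpty pOcc η u n, u n) :=
    fun u => by rw [walk_succ_eq, apply_ite f]
  have hint : Integrable F ((uniformSeqLaw.map fun u => walk pEmpty pOcc η u n).prod volume) := by
    rw [← map_walk_prodMk, integrable_map_measure hF.aestronglyMeasurable hXU.aemeasurable]
    exact (integrable_comp_walk η (n + 1) f).congr (.of_forall hsucc)
  calc ∫ u, f (walk pEmpty pOcc η u (n + 1)) ∂uniformSeqLaw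
      = ∫ r, F r ∂((uniformSeqLaw.map fun u => walk pEmpty pOcc η u n).prod volume) := by
        simp_rw [hsucc]
        rw [← map_walk_prodMk, integral_map hXU.aemeasurable hF.aestronglyMeasurable]
    _ = ∫ x, stepMean (jumpField pEmpty pOcc η n) f x
          ∂(uniformSeqLaw.map fun u => walk pEmpty pOcc η u n) := by
        rw [integral_prod _ hint]
        exact integral_congr_ae (.of_forall fun x =>
          integral_unitInterval_ite_le (q x) (f (x + 1)) (f (x - 1)))
    _ = ∫ u, stepMean (jumpField pEmpty pOcc η n) f (walk pEmpty pOcc η u n) ∂uniformSeqLaw :=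
        integral_map hX.aemeasurable (measurable_of_countable _).aestronglyMeasurable

lemma integral_comp_walk (η : T → Config) (n : ℕ) (f : ℤ → ℝ) :
    ∫ u, f (walk pEmpty pOcc η u n) ∂uniformSeqLaw =
      walkMean (jumpField pEmpty pOcc η) n f 0 := by
  induction n generalizing f with
  | zero => simp [walk]
  | succ n ih => rw [integral_comp_walk_succ, ih, walkMean_succ]

lemma annealedLaw_eq_map_prod (P : Measure (T → Config)) :
    annealedLaw pEmpty pOcc P =
      (P.prod uniformSeqLaw).map fun q => walk pEmpty pOcc q.1 q.2 := by
  have hm := measurable_walk_joint (T := T) pEmpty pOcc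
  ext s hs
  rw [annealedLaw, Measure.bind_apply hs (measurable_quenchedLaw pEmpty pOcc).aemeasurable,
    Measure.map_apply hm hs, Measure.prod_apply (hm hs)]
  refine lintegral_congr fun η => ?_
  rw [quenchedLaw, Measure.map_apply (measurable_walk η) hs]
  rfl

lemma integral_annealedLaw (P : Measure (T → Config)) [IsFiniteMeasure P] (n : ℕ) :
    ∫ X : ℕ → ℤ, (X n : ℝ) ∂(annealedLaw pEmpty pOcc P) =
      ∫ η, quenchedMean pEmpty pOcc n η ∂P := by
  have hm := measurable_walk_joint (T := T) pEmpty pOcc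
  have hn : Measurable fun X : ℕ → ℤ => (X n : ℝ) := by fun_prop
  rw [annealedLaw_eq_map_prod, integral_map hm.aemeasurable hn.aestronglyMeasurable, integral_prod]
  · exact integral_congr_ae (.of_forall fun η => integral_comp_walk η n Int.cast)
  · refine Integrable.of_bound (hn.comp hm).aestronglyMeasurable n (.of_forall fun q => ?_)
    rw [Real.norm_eq_abs]
    exact_mod_cast abs_walk_le q.1 q.2 n

end quenched

/-! ### Integrals against kernels and couplings -/

lemma integral_measure_bind {α β F : Type*} [MeasurableSpace α] [MeasurableSpace β]
    [NormedAddCommGroup F] [NormedSpace ℝ F] {μ : Measure α} {κ : Kernel α β} {f : β → F}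
    (hf : Integrable f (μ.bind κ)) :
    ∫ b, f b ∂(μ.bind κ) = ∫ a, ∫ b, f b ∂(κ a) ∂μ := by
  rw [Measure.comp_eq_comp_const_apply] at hf ⊢
  rw [Kernel.integral_comp hf, Kernel.const_apply]

lemma integral_le_of_le_off {Ω : Type*} [MeasurableSpace Ω] {μ : Measure Ω} [IsProbabilityMeasure μ]
    {g : Ω → ℝ} (hg : Integrable g μ) {S : Set Ω} (hS : MeasurableSet S) {B c N : ℝ} (hc : 0 ≤ c)
    (hN : μ.real S ≤ N) (hoff : ∀ ω, ω ∉ S → g ω ≤ B) (hall : ∀ ω, g ω ≤ B + c) :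
    ∫ ω, g ω ∂μ ≤ B + c * N := by
  have hind : Integrable (S.indicator fun _ => c) μ := (integrable_const _).indicator hS
  calc ∫ ω, g ω ∂μ ≤ ∫ ω, (B + S.indicator (fun _ => c) ω) ∂μ := by
        refine integral_mono hg ((integrable_const B).add hind) fun ω => ?_
        by_cases hω : ω ∈ S
        · simpa [hω] using hall ω
        · simpa [hω] using hoff ω hω
    _ = B + μ.real S * c := by
        rw [integral_add (integrable_const B) hind, integral_indicator_const _ hS]
        simp
    _ ≤ B + c * N := by
        rw [mul_comm c]
        gcongr

lemma abs_integral_le_of_abs_le {Ω : Type*} [MeasurableSpace Ω] {μ : Measure Ω}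
    [IsProbabilityMeasure μ] {f : Ω → ℝ} {c : ℝ} (h : ∀ ω, |f ω| ≤ c) : |∫ ω, f ω ∂μ| ≤ c := by
  simpa using norm_integral_le_of_norm_le_const (μ := μ) (f := f) (.of_forall h)

namespace IsCoupling

variable {Ω Ω' : Type*} [MeasurableSpace Ω] [MeasurableSpace Ω'] {Q : Measure (Ω × Ω')}
  {P : Measure Ω} {P' : Measure Ω'}

lemma isProbabilityMeasure [IsProbabilityMeasure P] (h : IsCoupling Q P P') :
    IsProbabilityMeasure Q := by
  have : IsProbabilityMeasure (Q.map Prod.fst) := h.1 ▸ ‹_›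
  exact Measure.isProbabilityMeasure_of_map Prod.fst

lemma integral_le [IsProbabilityMeasure P] (hQ : IsCoupling Q P P') {f : Ω → ℝ} {f' : Ω' → ℝ}
    (hf : Measurable f) (hf' : Measurable f') {a c q : ℝ} (ha : 0 ≤ a) (hc : 0 ≤ c)
    (hfc : ∀ ω, |f ω| ≤ c) (hfc' : ∀ ω, |f' ω| ≤ c) {G : Set (Ω × Ω')} (hG : 1 - q ≤ Q.real G)
    (hle : ∀ r ∈ G, f' r.2 ≤ f r.1 + a) :
    ∫ ω, f' ω ∂P' ≤ ∫ ω, f ω ∂P + a + 2 * c * q := by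
  have := hQ.isProbabilityMeasure
  let S : Set (Ω × Ω') := {r | f' r.2 ≤ f r.1 + a}
  have hS : MeasurableSet S :=
    measurableSet_le (hf'.comp measurable_snd) ((hf.comp measurable_fst).add_const a)
  have hGS : Q.real G ≤ Q.real S := measureReal_mono hle
  have hi : Integrable (fun r : Ω × Ω' => f r.1) Q :=
    .of_bound (hf.comp measurable_fst).aestronglyMeasurable c (.of_forall fun r => hfc _)
  have hi' : Integrable (fun r : Ω × Ω' => f' r.2) Q :=
    .of_bound (hf'.comp measurable_snd).aestronglyMeasurable c (.of_forall fun r => hfc' _)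
  have hdiff : ∫ r, f' r.2 - f r.1 ∂Q ≤ a + 2 * c * q :=
    integral_le_of_le_off (hi'.sub hi) hS.compl (by linarith)
      (by rw [probReal_compl_eq_one_sub hS]; linarith)
      (fun r hr => sub_le_iff_le_add'.2 (not_not.1 hr))
      (fun r => by
        rw [Pi.sub_apply]
        linarith [(abs_le.1 (hfc r.1)).1, (abs_le.1 (hfc' r.2)).2])
  rw [← hQ.1, ← hQ.2, integral_map measurable_fst.aemeasurable hf.aestronglyMeasurable,
    integral_map measurable_snd.aemeasurable hf'.aestronglyMeasurable]
  rw [integral_sub hi' hi] at hdiff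
  linarith

end IsCoupling

/-! ### The Markov property -/

/-- The configuration seen from `x`, i.e. `ζ (x + ·)`. -/
def seenFrom (x : ℤ) (ζ : Config) : Config := fun y => ζ (x + y)

lemma measurable_seenFrom (x : ℤ) : Measurable (seenFrom x) :=
  measurable_pi_lambda _ fun _ => measurable_pi_apply _

/-- The environment after time `s`, seen from `x`. -/
def shiftPath {T : Type*} [Add T] (s : T) (x : ℤ) (η : T → Config) : T → Config :=
  fun t => seenFrom x (η (s + t))

lemma measurable_shiftPath {T : Type*} [Add T] (s : T) (x : ℤ) : Measurable (shiftPath s x) :=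
  measurable_pi_lambda _ fun t => (measurable_seenFrom x).comp (measurable_pi_apply (s + t))

lemma jumpField_shiftPath {T : Type*} [AddMonoidWithOne T] (pEmpty pOcc : ℝ) (n : ℕ) (x : ℤ)
    (η : T → Config) :
    jumpField pEmpty pOcc (shiftPath (n : T) x η) =
      fun k z => jumpField pEmpty pOcc η (n + k) (x + z) := by
  funext k z
  simp [jumpField, shiftPath, seenFrom]

lemma measurable_seenFrom_eval {T : Type*} (s : T) (x : ℤ) :
    Measurable fun η : T → Config => seenFrom x (η s) :=
  (measurable_seenFrom x).comp (measurable_pi_apply s)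

namespace RandomEnvironment

section markov

lemma past_le {T : Type*} [LE T] (s : T) :
    past s ≤ (MeasurableSpace.pi : MeasurableSpace (T → Config)) :=
  Measurable.comap_le (measurable_pi_lambda _ fun r => measurable_pi_apply r.1)

lemma measurable_eval_past {T : Type*} [LE T] {r s : T} (h : r ≤ s) :
    Measurable[past s] fun η : T → Config => η r :=
  Measurable.comp (g := fun ξ : {r : T // r ≤ s} → Config => ξ ⟨r, h⟩) (measurable_pi_apply _)
    (comap_measurable _)

variable {T : Type*} {E : RandomEnvironment T}

/-- The law, given the path `η` up to time `s`, of the environment after time `s` seen from `x`. -/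
noncomputable def markovKernel (E : RandomEnvironment T) (s : T) (x : ℤ) :
    Kernel (T → Config) (T → Config) :=
  E.law.comap (fun η => seenFrom x (η s)) (measurable_seenFrom_eval s x)

instance (s : T) (x : ℤ) : IsMarkovKernel (E.markovKernel s x) := by
  unfold markovKernel; infer_instance

variable [CommSemiring T] [LinearOrder T]

/-- Under `P`, the environment after time `s` seen from `x` has conditional law
`𝐏^{η_s(x + ·)}` given the past of `s`. -/
def HasMarkovProperty (E : RandomEnvironment T) (P : Measure (T → Config)) : Prop :=
  ∀ (s : T) (x : ℤ) (A B : Set (T → Config)), MeasurableSet[past s] A → MeasurableSet B →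
    P (A ∩ shiftPath s x ⁻¹' B) = ∫⁻ η in A, E.markovKernel s x η B ∂P

lemma MarkovInvariant.law (h : E.MarkovInvariant) (ζ : Config) :
    E.HasMarkovProperty (E.law ζ) := h.2 ζ

lemma MarkovInvariant.stationaryLaw (h : E.MarkovInvariant) (ρ : ℝ) :
    E.HasMarkovProperty (E.stationaryLaw ρ) := by
  intro s x A B hA hB
  have hA' : MeasurableSet A := past_le s A hA
  rw [RandomEnvironment.stationaryLaw,
    Measure.bind_apply (hA'.inter (measurable_shiftPath s x hB)) E.law.aemeasurable,
    ← lintegral_indicator hA', Measure.lintegral_bind E.law.aemeasurable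
      (((E.markovKernel s x).measurable_coe hB).indicator hA').aemeasurable]
  refine lintegral_congr fun ζ => ?_
  rw [lintegral_indicator hA']
  exact h.law ζ s x A B hA hB

namespace HasMarkovProperty

variable {P : Measure (T → Config)} {s : T} {x : ℤ} {g φ : (T → Config) → ℝ}

lemma map_shiftPath_restrict (h : E.HasMarkovProperty P) (s : T) (x : ℤ) {A : Set (T → Config)}
    (hA : MeasurableSet[past s] A) :
    (P.restrict A).map (shiftPath s x) = (P.restrict A).bind (E.markovKernel s x) := by
  ext B hB
  rw [Measure.map_apply (measurable_shiftPath s x) hB,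
    Measure.restrict_apply (measurable_shiftPath s x hB), Set.inter_comm, h s x A B hA hB,
    Measure.bind_apply hB (E.markovKernel s x).aemeasurable]

lemma condExp_comp_shiftPath [IsFiniteMeasure P] (h : E.HasMarkovProperty P) (hg : Measurable g)
    (hgi : Integrable (fun η => g (shiftPath s x η)) P) :
    P[fun η => g (shiftPath s x η) | past s] =ᵐ[P]
      fun η => ∫ ξ, g ξ ∂(E.law (seenFrom x (η s))) := by
  have hgA : ∀ A, MeasurableSet[past s] A →
      Integrable g ((P.restrict A).bind (E.markovKernel s x)) := fun A hA => by
    rw [← h.map_shiftPath_restrict s x hA]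
    exact (integrable_map_measure hg.aestronglyMeasurable
      (measurable_shiftPath s x).aemeasurable).2 hgi.integrableOn
  refine (ae_eq_condExp_of_forall_setIntegral_eq (past_le s) hgi (fun A hA _ => ?_)
    (fun A hA _ => ?_) (StronglyMeasurable.aestronglyMeasurable ?_)).symm
  · have hint := hgA A hA
    rw [Measure.comp_eq_comp_const_apply] at hint
    exact hint.integral_comp
  · rw [← integral_map (f := g) (measurable_shiftPath s x).aemeasurable hg.aestronglyMeasurable,
      h.map_shiftPath_restrict s x hA, integral_measure_bind (hgA A hA)]
    rfl
  · exact hg.stronglyMeasurable.integral_kernel.comp_measurable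
      ((measurable_seenFrom x).comp (measurable_eval_past le_rfl))

lemma integral_mul_comp_shiftPath [IsFiniteMeasure P] (h : E.HasMarkovProperty P)
    (hφ : Measurable[past s] φ) {c C : ℝ} (hc : ∀ η, |φ η| ≤ c) (hg : Measurable g)
    (hC : ∀ η, |g η| ≤ C) :
    ∫ η, φ η * g (shiftPath s x η) ∂P =
      ∫ η, φ η * ∫ ξ, g ξ ∂(E.law (seenFrom x (η s))) ∂P := by
  have hgi : Integrable (fun η : T → Config => g (shiftPath s x η)) P :=
    .of_bound (hg.comp (measurable_shiftPath s x)).aestronglyMeasurable C (.of_forall fun η => hC _)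
  calc ∫ η, φ η * g (shiftPath s x η) ∂P
      = ∫ η, (P[φ * (fun η => g (shiftPath s x η)) | past s]) η ∂P :=
        (integral_condExp (past_le s)).symm
    _ = ∫ η, φ η * ∫ ξ, g ξ ∂(E.law (seenFrom x (η s))) ∂P := by
        refine integral_congr_ae ?_
        filter_upwards [condExp_stronglyMeasurable_mul_of_bound (past_le s) hφ.stronglyMeasurable
          hgi c (.of_forall hc), h.condExp_comp_shiftPath hg hgi] with η hpull hcond
        rw [hpull, Pi.mul_apply, hcond]

end HasMarkovProperty

lemma MarkovInvariant.map_eval_zero_stationaryLaw (h : E.MarkovInvariant) (ρ : ℝ) :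
    (E.stationaryLaw ρ).map (fun η => η 0) = E.μ ρ := by
  have hm : Measurable fun η : T → Config => η 0 := measurable_pi_apply 0
  have hdirac : E.law.map (fun η => η 0) = Kernel.id := by
    ext1 ζ
    rw [Kernel.map_apply _ hm, Measure.map_congr (h.1 ζ), Measure.map_const, measure_univ, one_smul,
      Kernel.id_apply]
  rw [RandomEnvironment.stationaryLaw, Measure.map_comp _ _ hm, hdirac, Measure.id_comp]

lemma MarkovInvariant.map_eval_stationaryLaw (h : E.MarkovInvariant) (hS : E.Stationary) {ρ : ℝ}
    (hρ : ρ ∈ E.J) (s : T) : (E.stationaryLaw ρ).map (fun η => η s) = E.μ ρ := by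
  have hm : Measurable fun (η : T → Config) (t : T) => η (t + s) :=
    measurable_pi_lambda _ fun t => measurable_pi_apply (t + s)
  rw [← h.map_eval_zero_stationaryLaw ρ]
  conv_rhs => rw [← hS ρ hρ s, Measure.map_map (measurable_pi_apply 0) hm]
  congr 1
  funext η
  simp

lemma MarkovInvariant.map_seenFrom_eval_stationaryLaw (h : E.MarkovInvariant) (hS : E.Stationary)
    (hT : E.TranslationInvariant) {ρ : ℝ} (hρ : ρ ∈ E.J) (s : T) (x : ℤ) :
    (E.stationaryLaw ρ).map (fun η => seenFrom x (η s)) = E.μ ρ := by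
  conv_rhs => rw [← hT ρ hρ x, ← h.map_eval_stationaryLaw hS hρ s]
  exact (Measure.map_map (measurable_seenFrom x) (measurable_pi_apply s)).symm

end markov

/-! ### Mean position and speed -/

section speed

variable {T : Type*} {E : RandomEnvironment T} {pEmpty pOcc : ℝ}

/-- The mean position after `n` steps in the environment started from `ζ`. -/
noncomputable def meanPosition [NatCast T] (E : RandomEnvironment T) (pEmpty pOcc : ℝ) (n : ℕ)
    (ζ : Config) : ℝ :=
  ∫ η, quenchedMean pEmpty pOcc n η ∂(E.law ζ)

lemma measurable_meanPosition [NatCast T] (n : ℕ) : Measurable (E.meanPosition pEmpty pOcc n) :=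
  (measurable_quenchedMean n).stronglyMeasurable.integral_kernel.measurable

lemma abs_meanPosition_le [NatCast T] (n : ℕ) (ζ : Config) :
    |E.meanPosition pEmpty pOcc n ζ| ≤ n :=
  abs_integral_le_of_abs_le (abs_quenchedMean_le n)

lemma integrable_quenchedMean [NatCast T] (P : Measure (T → Config)) [IsFiniteMeasure P] (n : ℕ) :
    Integrable (quenchedMean pEmpty pOcc n) P :=
  .of_bound (measurable_quenchedMean n).aestronglyMeasurable n (.of_forall (abs_quenchedMean_le n))

lemma integral_quenchedMean_stationaryLaw [NatCast T] (ρ : ℝ) (n : ℕ) :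
    ∫ η, quenchedMean pEmpty pOcc n η ∂(E.stationaryLaw ρ) =
      ∫ ζ, E.meanPosition pEmpty pOcc n ζ ∂(E.μ ρ) :=
  integral_measure_bind (integrable_quenchedMean (E.stationaryLaw ρ) n)

variable [CommSemiring T] [LinearOrder T] [Sub T] [FloorSemiring T]

instance (ρ : ℝ) (L : ℕ) : IsProbabilityMeasure (E.finiteRangeLaw ρ L) :=
  Measure.isProbabilityMeasure_map (measurable_pi_lambda _ fun _ =>
    (measurable_pi_apply _).comp (measurable_pi_apply _)).aemeasurable

variable [IsStrictOrderedRing T] [OrderedSub T]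

lemma integral_quenchedMean_finiteRangeLaw (ρ : ℝ) (L : ℕ) :
    ∫ η, quenchedMean pEmpty pOcc L η ∂(E.finiteRangeLaw ρ L) =
      ∫ η, quenchedMean pEmpty pOcc L η ∂(E.stationaryLaw ρ) := by
  have hm : Measurable fun (ω : ℕ → T → Config) (t : T) =>
      ω (⌊t⌋₊ / L) (t - ((⌊t⌋₊ / L * L : ℕ) : T)) :=
    measurable_pi_lambda _ fun _ => (measurable_pi_apply _).comp (measurable_pi_apply _)
  have hq : StronglyMeasurable (quenchedMean pEmpty pOcc L : (T → Config) → ℝ) :=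
    (measurable_quenchedMean L).stronglyMeasurable
  rw [finiteRangeLaw, integral_map hm.aemeasurable hq.aestronglyMeasurable]
  conv_rhs => rw [← Measure.infinitePi_map_eval (fun _ : ℕ => E.stationaryLaw ρ) 0]
  rw [integral_map (measurable_pi_apply 0).aemeasurable hq.aestronglyMeasurable]
  exact integral_congr_ae (.of_forall fun ω => quenchedMean_congr fun k hk => by
    simp [Nat.div_eq_of_lt hk])

lemma rangeSpeed_eq (ρ : ℝ) (L : ℕ) :
    E.rangeSpeed pEmpty pOcc ρ L = (∫ ζ, E.meanPosition pEmpty pOcc L ζ ∂(E.μ ρ)) / L := by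
  rw [rangeSpeed, integral_div, integral_annealedLaw, integral_quenchedMean_finiteRangeLaw,
    integral_quenchedMean_stationaryLaw]

lemma abs_rangeSpeed_le (ρ : ℝ) (L : ℕ) : |E.rangeSpeed pEmpty pOcc ρ L| ≤ 1 := by
  rw [rangeSpeed_eq, abs_div, Nat.abs_cast]
  exact div_le_one_of_le₀ (abs_integral_le_of_abs_le (abs_meanPosition_le L)) (Nat.cast_nonneg L)

end speed

end RandomEnvironment

/-! ### Typical configurations -/

lemma measurable_count (a b : ℤ) : Measurable fun ζ : Config => count ζ a b :=
  Finset.measurable_sum _ fun x _ => measurable_pi_apply x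

lemma count_seenFrom (ζ : Config) (x a b : ℤ) :
    count (seenFrom x ζ) a b = count ζ (x + a) (x + b) := by
  rw [count, count, ← Finset.map_add_left_Icc, Finset.sum_map]
  rfl

/-- The configurations whose empirical density on `[a, b]` is at distance at least `ε` from `ρ`. -/
def deviationSet (ρ ε : ℝ) (a b : ℤ) : Set Config :=
  {ζ | ε * ((b - a + 1 : ℤ) : ℝ) ≤ |(count ζ a b : ℝ) - ρ * ((b - a + 1 : ℤ) : ℝ)|}

/-- The configurations whose empirical density is within `ε` of `ρ` on all the intervals in
`[-H, H]` that have length between `⌊l / 2⌋` and `l`, which are those of the covering condition. -/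
def typicalSet (H l : ℕ) (ρ ε : ℝ) : Set Config :=
  {ζ | ∀ a b : ℤ, -(H : ℤ) ≤ a → a ≤ b → b ≤ H → ((l / 2 : ℕ) : ℤ) ≤ b - a + 1 →
    b - a + 1 ≤ (l : ℤ) → ζ ∉ deviationSet ρ ε a b}

lemma notMem_deviationSet {ρ ε : ℝ} {a b : ℤ} {ζ : Config} : ζ ∉ deviationSet ρ ε a b ↔
    |(count ζ a b : ℝ) - ρ * ((b - a + 1 : ℤ) : ℝ)| < ε * ((b - a + 1 : ℤ) : ℝ) := by
  rw [deviationSet, Set.mem_ofPred_eq, not_le]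

lemma measurableSet_deviationSet (ρ ε : ℝ) (a b : ℤ) : MeasurableSet (deviationSet ρ ε a b) :=
  measurableSet_le measurable_const
    ((measurable_from_top.comp (measurable_count a b)).sub_const _ |>.abs)

lemma measurableSet_typicalSet (H l : ℕ) (ρ ε : ℝ) : MeasurableSet (typicalSet H l ρ ε) := by
  simp only [typicalSet, Set.ofPred_forall]
  exact .iInter fun a => .iInter fun b => .iInter fun _ => .iInter fun _ => .iInter fun _ =>
    .iInter fun _ => .iInter fun _ => (measurableSet_deviationSet ρ ε a b).compl

lemma seenFrom_preimage_deviationSet (ρ ε : ℝ) (x a b : ℤ) :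
    seenFrom x ⁻¹' deviationSet ρ ε a b = deviationSet ρ ε (x + a) (x + b) := by
  ext ζ
  simp only [deviationSet, Set.mem_preimage, Set.mem_ofPred_eq, count_seenFrom,
    add_sub_add_left_eq_sub]

lemma compl_typicalSet_subset (H l : ℕ) (ρ ε : ℝ) :
    (typicalSet H l ρ ε)ᶜ ⊆
      ⋃ r ∈ (Finset.Icc (-(H : ℤ)) H ×ˢ Finset.Icc (-(H : ℤ)) H).filter
        (fun r => r.1 ≤ r.2 ∧ (l : ℤ) ≤ 3 * (r.2 - r.1 + 1)), deviationSet ρ ε r.1 r.2 := by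
  intro ζ hζ
  simp only [typicalSet, Set.mem_compl_iff, Set.mem_ofPred_eq] at hζ
  push Not at hζ
  obtain ⟨a, b, ha, hab, hb, hl, -, hdev⟩ := hζ
  refine Set.mem_biUnion (x := (a, b)) ?_ hdev
  simp only [Finset.coe_filter, Finset.mem_product, Finset.mem_Icc, Set.mem_ofPred_eq]
  omega

namespace RandomEnvironment

section typical

variable {T : Type*} [CommSemiring T] [LinearOrder T] {E : RandomEnvironment T}

lemma DensityAtStationarity.exists_measureReal_deviationSet_le (hD : E.DensityAtStationarity)
    (hM : E.MarkovInvariant) (hT : E.TranslationInvariant) :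
    ∃ c : ℝ, 0 < c ∧ ∀ ρ ∈ E.J, ∀ ε ∈ Set.Ioo (0 : ℝ) 1, ∀ a b : ℤ, a ≤ b →
      (E.μ ρ).real (deviationSet ρ ε a b) ≤
        2 * Real.exp (-c * ε ^ 2 * ((b - a + 1 : ℤ) : ℝ)) := by
  obtain ⟨c, hc, hdev⟩ := hD
  refine ⟨c, hc, fun ρ hρ ε hε a b hab => ?_⟩
  obtain ⟨n, rfl⟩ : ∃ n : ℕ, b = a + n := ⟨(b - a).toNat, by omega⟩
  have hn : a + (n : ℤ) - a + 1 = ((n + 1 : ℕ) : ℤ) := by push_cast; ring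
  have htransl := map_measureReal_apply (μ := E.μ ρ) (measurable_seenFrom a)
    (measurableSet_deviationSet ρ ε 0 n)
  rw [seenFrom_preimage_deviationSet, add_zero] at htransl
  have hzero := map_measureReal_apply (μ := E.stationaryLaw ρ) (measurable_pi_apply (0 : T))
    (measurableSet_deviationSet ρ ε 0 n)
  rw [hM.map_eval_zero_stationaryLaw] at hzero
  have hinv : (E.μ ρ).map (seenFrom a) = E.μ ρ := hT ρ hρ a
  rw [← htransl, hinv, hzero, hn, Int.cast_natCast]
  simpa [deviationSet] using hdev ρ hρ ε hε (n + 1) (by omega)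

lemma DensityAtStationarity.exists_measureReal_compl_typicalSet_le
    (hD : E.DensityAtStationarity) (hM : E.MarkovInvariant) (hT : E.TranslationInvariant) :
    ∃ c : ℝ, 0 < c ∧ ∀ ρ ∈ E.J, ∀ ε ∈ Set.Ioo (0 : ℝ) 1, ∀ H l : ℕ,
      (E.μ ρ).real (typicalSet H l ρ ε)ᶜ ≤
        (2 * H + 1) ^ 2 * (2 * Real.exp (-c * ε ^ 2 * (l / 3))) := by
  obtain ⟨c, hc, hdev⟩ := hD.exists_measureReal_deviationSet_le hM hT
  refine ⟨c, hc, fun ρ hρ ε hε H l => ?_⟩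
  set W := Finset.Icc (-(H : ℤ)) H
  set K := (W ×ˢ W).filter fun r => r.1 ≤ r.2 ∧ (l : ℤ) ≤ 3 * (r.2 - r.1 + 1)
  have hcard : (K.card : ℝ) ≤ (2 * H + 1) ^ 2 := by
    have hW : W.card = 2 * H + 1 := by simp only [W, Int.card_Icc]; omega
    have hK : K.card ≤ (2 * H + 1) ^ 2 :=
      (Finset.card_filter_le _ _).trans_eq (by rw [Finset.card_product, hW, sq])
    exact_mod_cast hK
  have hterm : ∀ r ∈ K,
      (E.μ ρ).real (deviationSet ρ ε r.1 r.2) ≤ 2 * Real.exp (-c * ε ^ 2 * (l / 3)) := by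
    intro r hr
    obtain ⟨hle, hlen⟩ := (Finset.mem_filter.1 hr).2
    have hlen' : (l : ℝ) / 3 ≤ ((r.2 - r.1 + 1 : ℤ) : ℝ) := by
      rw [div_le_iff₀' three_pos]
      exact_mod_cast hlen
    refine (hdev ρ hρ ε hε r.1 r.2 hle).trans ?_
    gcongr 2 * Real.exp ?_
    exact mul_le_mul_of_nonpos_left hlen' (by nlinarith [sq_nonneg ε])
  calc (E.μ ρ).real (typicalSet H l ρ ε)ᶜ
      ≤ (E.μ ρ).real (⋃ r ∈ K, deviationSet ρ ε r.1 r.2) :=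
        measureReal_mono (compl_typicalSet_subset H l ρ ε) (measure_ne_top _ _)
    _ ≤ ∑ r ∈ K, (E.μ ρ).real (deviationSet ρ ε r.1 r.2) := measureReal_biUnion_finset_le _ _
    _ ≤ K.card • (2 * Real.exp (-c * ε ^ 2 * (l / 3))) := Finset.sum_le_card_nsmul _ _ _ hterm
    _ ≤ (2 * H + 1) ^ 2 * (2 * Real.exp (-c * ε ^ 2 * (l / 3))) := by
        rw [nsmul_eq_mul]
        gcongr

end typical

end RandomEnvironment

/-! ### Comparison of mean positions -/

/-- `ζ' ≤ ζ` on the window `[-r, r]`. -/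
def DominatedWithin (r : ℝ) (ζ' ζ : Config) : Prop := ∀ x : ℤ, |(x : ℝ)| ≤ r → ζ' x ≤ ζ x

lemma DominatedWithin.seenFrom {r s : ℝ} {ζ' ζ : Config} (h : DominatedWithin r ζ' ζ) {x : ℤ}
    (hx : |(x : ℝ)| + s ≤ r) : DominatedWithin s (seenFrom x ζ') (seenFrom x ζ) := fun y hy =>
  h (x + y) (by
    push_cast
    exact (abs_add_le _ _).trans (by linarith))

section restart

variable {T : Type*} [AddMonoidWithOne T] {pEmpty pOcc : ℝ}

lemma walkMean_jumpField_add (n m : ℕ) (x : ℤ) (η : T → Config) :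
    walkMean (fun k => jumpField pEmpty pOcc η (n + k)) m Int.cast x =
      x + quenchedMean pEmpty pOcc m (shiftPath (n : T) x η) := by
  have htransl := walkMean_translate (fun k => jumpField pEmpty pOcc η (n + k)) m Int.cast x 0
  have hsplit : (fun z : ℤ => ((x + z : ℤ) : ℝ)) = (fun _ => (x : ℝ)) + Int.cast := by
    funext z
    simp
  rw [add_zero, hsplit, map_add, walkMean_const] at htransl
  rw [htransl, quenchedMean, jumpField_shiftPath]
  rfl

lemma quenchedMean_add (n m : ℕ) (η : T → Config) :
    quenchedMean pEmpty pOcc (n + m) η = quenchedMean pEmpty pOcc n η +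
      ∑ x ∈ Finset.Icc (-(n : ℤ)) n,
        quenchedProb pEmpty pOcc n x η * quenchedMean pEmpty pOcc m (shiftPath (n : T) x η) := by
  rw [quenchedMean, walkMean_add, walkMean_eq_sum, ← sum_quenchedProb_mul,
    ← Finset.sum_add_distrib]
  refine Finset.sum_congr rfl fun x _ => ?_
  rw [walkMean_jumpField_add, mul_add, quenchedProb]

lemma quenchedMean_shiftPath_sub_le (t L : ℕ) (η : T → Config) :
    quenchedMean pEmpty pOcc L (shiftPath (t : T) (-t) η) - t ≤
      quenchedMean pEmpty pOcc (t + L) η := by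
  have hleft := apply_sub_le_walkMean (jumpField pEmpty pOcc η) t
    (fun x => walkMean_le_walkMean_add_two (fun k => jumpField pEmpty pOcc η (t + k))
      (n := L) (f := Int.cast) (fun x => by norm_num) x) 0
  rw [← walkMean_add, zero_sub, walkMean_jumpField_add] at hleft
  push_cast at hleft
  rw [quenchedMean.eq_1 _ _ (t + L)]
  linarith

end restart

namespace RandomEnvironment

section comparison

variable {T : Type*} {E : RandomEnvironment T} {pEmpty pOcc : ℝ}

/-- The environments started from `ζ` and `ζ'` can be coupled so that at time `t`, outside of an
event of probability at most `q`, the former covers the latter on `[-r, r]`. -/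
def CoversWithin (E : RandomEnvironment T) (t : T) (r q : ℝ) (ζ ζ' : Config) : Prop :=
  ∃ Q : Measure ((T → Config) × (T → Config)), IsCoupling Q (E.law ζ) (E.law ζ') ∧
    1 - q ≤ Q.real {p | DominatedWithin r (p.2 t) (p.1 t)}

lemma CoversWithin.mono {t : T} {r q q' : ℝ} {ζ ζ' : Config} (h : E.CoversWithin t r q ζ ζ')
    (hq : q ≤ q') : E.CoversWithin t r q' ζ ζ' :=
  h.imp fun _ hQ => ⟨hQ.1, (sub_le_sub_left hq 1).trans hQ.2⟩

variable [CommSemiring T]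

lemma NoDriftFromSide.meanPosition_le (hp : pEmpty ≤ pOcc) {ν : ℝ} (hν : E.NoDriftFromSide ν)
    {L H : ℕ} (hH : L + 2 * ν * L ≤ (H : ℝ)) {ζ' ζ : Config} (h : DominatedWithin H ζ' ζ) :
    E.meanPosition pEmpty pOcc L ζ' ≤
      E.meanPosition pEmpty pOcc L ζ + 2 * L * (20 * Real.exp (-(ν * L) / 4)) := by
  obtain ⟨Q, hQ, hG⟩ := hν L H 1 le_rfl ζ ζ' fun x hx hx' =>
    h x (by exact_mod_cast abs_le.2 ⟨hx, hx'⟩)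
  have hmono : ∀ p ∈ {p : (T → Config) × (T → Config) | ∀ s : ℕ, s ≤ L → ∀ x : ℤ,
      -(H : ℝ) + 2 * ν * (1 : ℕ) * L ≤ x → (x : ℝ) ≤ H - 2 * ν * (1 : ℕ) * L →
        p.2 (s : T) x ≤ p.1 (s : T) x},
      quenchedMean pEmpty pOcc L p.2 ≤ quenchedMean pEmpty pOcc L p.1 + 0 := by
    intro p hle
    rw [add_zero]
    refine quenchedMean_mono hp fun k hk x hx => hle k hk.le x ?_ ?_ <;>
    · have hxL : |(x : ℝ)| ≤ L := by exact_mod_cast hx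
      push_cast
      linarith [abs_le.1 hxL]
  have hint := hQ.integral_le (measurable_quenchedMean L) (measurable_quenchedMean L) le_rfl
    (Nat.cast_nonneg L) (abs_quenchedMean_le L) (abs_quenchedMean_le L) hG hmono
  rwa [add_zero, Nat.cast_one, one_mul] at hint

lemma CoversWithin.integral_meanPosition_seenFrom_le (hp : pEmpty ≤ pOcc) {ν : ℝ}
    (hν : E.NoDriftFromSide ν) {t : T} {L H : ℕ} {r q : ℝ} {ζ ζ' : Config}
    (hcov : E.CoversWithin t r q ζ ζ') (hH : L + 2 * ν * L ≤ (H : ℝ)) {x : ℤ}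
    (hx : |(x : ℝ)| + H ≤ r) :
    ∫ η, E.meanPosition pEmpty pOcc L (seenFrom x (η t)) ∂(E.law ζ') ≤
      ∫ η, E.meanPosition pEmpty pOcc L (seenFrom x (η t)) ∂(E.law ζ) +
        2 * L * (20 * Real.exp (-(ν * L) / 4)) + 2 * L * q := by
  obtain ⟨Q, hQ, hG⟩ := hcov
  have hm : Measurable fun η : T → Config => E.meanPosition pEmpty pOcc L (seenFrom x (η t)) :=
    (measurable_meanPosition L).comp (measurable_seenFrom_eval t x)
  exact hQ.integral_le hm hm (by positivity) (Nat.cast_nonneg L) (fun η => abs_meanPosition_le L _)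
    (fun η => abs_meanPosition_le L _) hG
    fun p hdom => hν.meanPosition_le hp hH (DominatedWithin.seenFrom hdom hx)

variable [LinearOrder T]

/-- During `t` steps the walk cannot get to the left of `-t`, and from time `t` on it stays to the
right of a walk that starts there. -/
lemma HasMarkovProperty.integral_meanPosition_seenFrom_sub_le {P : Measure (T → Config)}
    [IsProbabilityMeasure P] (h : E.HasMarkovProperty P) (t L : ℕ) :
    ∫ η, E.meanPosition pEmpty pOcc L (seenFrom (-t) (η (t : T))) ∂P - t ≤
      ∫ η, quenchedMean pEmpty pOcc (t + L) η ∂P := by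
  have hi : Integrable
      (fun η : T → Config => quenchedMean pEmpty pOcc L (shiftPath (t : T) (-t) η)) P :=
    .of_bound ((measurable_quenchedMean L).comp (measurable_shiftPath _ _)).aestronglyMeasurable L
      (.of_forall fun η => abs_quenchedMean_le L _)
  have hmarkov : ∫ η, quenchedMean pEmpty pOcc L (shiftPath (t : T) (-t) η) ∂P =
      ∫ η, E.meanPosition pEmpty pOcc L (seenFrom (-t) (η (t : T))) ∂P := by
    simpa only [one_mul, meanPosition] using h.integral_mul_comp_shiftPath (s := (t : T)) (x := -t)
      (φ := fun _ => 1) measurable_const (c := 1) (by simp) (measurable_quenchedMean L)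
      (abs_quenchedMean_le L)
  calc ∫ η, E.meanPosition pEmpty pOcc L (seenFrom (-t) (η (t : T))) ∂P - t
      = ∫ η, (quenchedMean pEmpty pOcc L (shiftPath (t : T) (-t) η) - t) ∂P := by
        rw [integral_sub hi (integrable_const _), hmarkov]
        simp
    _ ≤ ∫ η, quenchedMean pEmpty pOcc (t + L) η ∂P :=
        integral_mono (hi.sub (integrable_const _)) (integrable_quenchedMean P _)
          fun η => quenchedMean_shiftPath_sub_le t L η

lemma integral_integral_meanPosition_seenFrom (hM : E.MarkovInvariant) (hS : E.Stationary)
    (hT : E.TranslationInvariant) {ρ : ℝ} (hρ : ρ ∈ E.J) (s : T) (x : ℤ) (n : ℕ) :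
    ∫ ζ, ∫ η, E.meanPosition pEmpty pOcc n (seenFrom x (η s)) ∂(E.law ζ) ∂(E.μ ρ) =
      ∫ ζ, E.meanPosition pEmpty pOcc n ζ ∂(E.μ ρ) := by
  have hm := measurable_seenFrom_eval (T := T) s x
  have hF := (measurable_meanPosition (E := E) (pEmpty := pEmpty) (pOcc := pOcc) n)
  rw [← integral_measure_bind]
  · conv_rhs => rw [← hM.map_seenFrom_eval_stationaryLaw hS hT hρ s x]
    exact (integral_map hm.aemeasurable hF.aestronglyMeasurable).symm
  · exact .of_bound (hF.comp hm).aestronglyMeasurable n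
      (.of_forall fun η => abs_meanPosition_le n _)

lemma integral_meanPosition_le_of_coversWithin (hp : pEmpty ≤ pOcc) (hM : E.MarkovInvariant)
    (hS : E.Stationary) (hT : E.TranslationInvariant) {ν : ℝ} (hν : E.NoDriftFromSide ν)
    {ρ r q N : ℝ} (hρ : ρ ∈ E.J) (hq : 0 ≤ q) {t L H : ℕ} {S : Set Config} (hS' : MeasurableSet S)
    {ζ : Config} (hcov : ∀ ζ' ∉ S, E.CoversWithin (t : T) r q ζ ζ')
    (hH : L + 2 * ν * L ≤ (H : ℝ)) (hr : t + H ≤ r) (hN : (E.μ ρ).real S ≤ N) :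
    ∫ ξ, E.meanPosition pEmpty pOcc L ξ ∂(E.μ ρ) ≤ E.meanPosition pEmpty pOcc (t + L) ζ + t +
      2 * L * (20 * Real.exp (-(ν * L) / 4) + q + N) := by
  set G : Config → ℝ := fun ζ' =>
    ∫ η, E.meanPosition pEmpty pOcc L (seenFrom (-t) (η (t : T))) ∂(E.law ζ')
  have hGm : Measurable G :=
    ((measurable_meanPosition L).comp
      (measurable_seenFrom_eval (t : T) (-t))).stronglyMeasurable.integral_kernel.measurable
  have hGL : ∀ ζ', |G ζ'| ≤ L := fun ζ' =>
    abs_integral_le_of_abs_le fun η => abs_meanPosition_le L _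
  have hcmp : ∀ ζ' ∉ S, G ζ' ≤ G ζ + 2 * L * (20 * Real.exp (-(ν * L) / 4)) + 2 * L * q :=
    fun ζ' hζ' => (hcov ζ' hζ').integral_meanPosition_seenFrom_le hp hν hH (by simpa using hr)
  have hrestart : G ζ - t ≤ E.meanPosition pEmpty pOcc (t + L) ζ :=
    (hM.law ζ).integral_meanPosition_seenFrom_sub_le t L
  have herr : 0 ≤ 2 * L * (20 * Real.exp (-(ν * L) / 4)) + 2 * L * q := by positivity
  calc ∫ ξ, E.meanPosition pEmpty pOcc L ξ ∂(E.μ ρ) = ∫ ζ', G ζ' ∂(E.μ ρ) :=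
        (integral_integral_meanPosition_seenFrom hM hS hT hρ (t : T) (-t) L).symm
    _ ≤ G ζ + 2 * L * (20 * Real.exp (-(ν * L) / 4)) + 2 * L * q + 2 * L * N :=
        integral_le_of_le_off
          (.of_bound hGm.aestronglyMeasurable L (.of_forall hGL)) hS' (by positivity) hN hcmp
          fun ζ' => by linarith [(abs_le.1 (hGL ζ')).2, (abs_le.1 (hGL ζ)).1]
    _ ≤ _ := by linarith

end comparison

end RandomEnvironment

/-! ### Decomposition into blocks -/

namespace RandomEnvironment

section blocks

variable {T : Type*} [CommSemiring T] [LinearOrder T] [IsStrictOrderedRing T]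
  {E : RandomEnvironment T} {pEmpty pOcc : ℝ}

lemma measurable_quenchedProb_past (n : ℕ) (x : ℤ) :
    Measurable[past (n : T)] (quenchedProb pEmpty pOcc n x : (T → Config) → ℝ) :=
  @measurable_walkMean (T → Config) (past (n : T)) (jumpField pEmpty pOcc)
    (fun _ => Pi.single x 1) n
    (fun _ hk y => @measurable_jumpField_apply T _ pEmpty pOcc (T → Config) (past (n : T)) id _
      (measurable_eval_past (Nat.cast_le.2 hk.le)) y) (fun _ => measurable_const) 0

lemma measurable_quenchedProb (n : ℕ) (x : ℤ) :
    Measurable (quenchedProb pEmpty pOcc n x : (T → Config) → ℝ) :=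
  (measurable_quenchedProb_past n x).mono (past_le _) le_rfl

lemma integrable_quenchedProb_mul (P : Measure (T → Config)) [IsFiniteMeasure P] (n : ℕ) (x : ℤ)
    {g : (T → Config) → ℝ} (hg : Measurable g) {c : ℝ} (hc : ∀ η, |g η| ≤ c) :
    Integrable (fun η => quenchedProb pEmpty pOcc n x η * g η) P := by
  refine .of_bound ((measurable_quenchedProb n x).mul hg).aestronglyMeasurable c
    (.of_forall fun η => ?_)
  obtain ⟨h0, h1⟩ := quenchedProb_mem_Icc (pEmpty := pEmpty) (pOcc := pOcc) n x η
  rw [Real.norm_eq_abs, abs_mul, abs_of_nonneg h0]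
  exact (mul_le_of_le_one_left (abs_nonneg _) h1).trans (hc η)

lemma HasMarkovProperty.integral_quenchedMean_add {P : Measure (T → Config)}
    [IsProbabilityMeasure P] (h : E.HasMarkovProperty P) (n m : ℕ) :
    ∫ η, quenchedMean pEmpty pOcc (n + m) η ∂P = ∫ η, quenchedMean pEmpty pOcc n η ∂P +
      ∑ x ∈ Finset.Icc (-(n : ℤ)) n, ∫ η, quenchedProb pEmpty pOcc n x η *
        E.meanPosition pEmpty pOcc m (seenFrom x (η (n : T))) ∂P := by
  have hint : ∀ x : ℤ, Integrable (fun η : T → Config => quenchedProb pEmpty pOcc n x η *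
      quenchedMean pEmpty pOcc m (shiftPath (n : T) x η)) P := fun x =>
    integrable_quenchedProb_mul P n x ((measurable_quenchedMean m).comp (measurable_shiftPath _ _))
      fun η => abs_quenchedMean_le m _
  simp only [quenchedMean_add n m]
  rw [integral_add (integrable_quenchedMean P n) (integrable_finsetSum _ fun x _ => hint x),
    integral_finsetSum _ fun x _ => hint x]
  refine congrArg _ (Finset.sum_congr rfl fun x _ => ?_)
  refine h.integral_mul_comp_shiftPath (measurable_quenchedProb_past n x) (c := 1)
    (fun η => ?_) (measurable_quenchedMean m) (abs_quenchedMean_le m)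
  obtain ⟨h0, h1⟩ := quenchedProb_mem_Icc (pEmpty := pEmpty) (pOcc := pOcc) n x η
  exact abs_le.2 ⟨by linarith, h1⟩

variable {ρ b N : ℝ} {m : ℕ} {S : Set Config}

lemma integral_quenchedProb_mul_meanPosition_ge (hM : E.MarkovInvariant) (hS : E.Stationary)
    (hT : E.TranslationInvariant) (hρ : ρ ∈ E.J) (hSm : MeasurableSet S)
    (hN : (E.μ ρ).real S ≤ N) (hbm : b ≤ m)
    (hb : ∀ ζ ∉ S, b ≤ E.meanPosition pEmpty pOcc m ζ) (n : ℕ) (x : ℤ) :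
    b * ∫ η, quenchedProb pEmpty pOcc n x η ∂(E.stationaryLaw ρ) - 2 * m * N ≤
      ∫ η, quenchedProb pEmpty pOcc n x η *
        E.meanPosition pEmpty pOcc m (seenFrom x (η (n : T))) ∂(E.stationaryLaw ρ) := by
  have hm := measurable_seenFrom_eval (n : T) x
  have hbad : (E.stationaryLaw ρ).real ((fun η => seenFrom x (η (n : T))) ⁻¹' S) ≤ N := by
    rwa [← map_measureReal_apply hm hSm, hM.map_seenFrom_eval_stationaryLaw hS hT hρ]
  have hF : ∀ η : T → Config, |E.meanPosition pEmpty pOcc m (seenFrom x (η (n : T)))| ≤ m :=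
    fun η => abs_meanPosition_le m _
  have hi := integrable_quenchedProb_mul (pEmpty := pEmpty) (pOcc := pOcc) (E.stationaryLaw ρ) n x
    ((measurable_meanPosition m).comp hm) hF
  have hib : Integrable (fun η : T → Config => quenchedProb pEmpty pOcc n x η * b)
      (E.stationaryLaw ρ) :=
    integrable_quenchedProb_mul _ n x measurable_const fun _ => le_rfl
  have hle := integral_le_of_le_off (hib.sub hi) (hm hSm) (B := 0) (c := 2 * m) (by positivity)
    hbad (fun η hη => ?_) (fun η => ?_)
  · rw [integral_sub' hib hi, integral_mul_const] at hle
    simp only [Function.comp_apply] at hle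
    linarith
  · have h0 := (quenchedProb_mem_Icc (pEmpty := pEmpty) (pOcc := pOcc) n x η).1
    exact sub_nonpos.2 (mul_le_mul_of_nonneg_left (hb _ hη) h0)
  · obtain ⟨h0, h1⟩ := quenchedProb_mem_Icc (pEmpty := pEmpty) (pOcc := pOcc) n x η
    have hgap : b - E.meanPosition pEmpty pOcc m (seenFrom x (η (n : T))) ≤ 2 * m := by
      linarith [(abs_le.1 (hF η)).1]
    calc _ = quenchedProb pEmpty pOcc n x η *
          (b - E.meanPosition pEmpty pOcc m (seenFrom x (η (n : T)))) := (mul_sub _ _ _).symm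
      _ ≤ quenchedProb pEmpty pOcc n x η * (2 * m) := mul_le_mul_of_nonneg_left hgap h0
      _ ≤ 0 + 2 * m := by
        rw [zero_add]
        exact mul_le_of_le_one_left (by positivity) h1

lemma integral_quenchedMean_add_ge (hM : E.MarkovInvariant) (hS : E.Stationary)
    (hT : E.TranslationInvariant) (hρ : ρ ∈ E.J) (hSm : MeasurableSet S)
    (hN : (E.μ ρ).real S ≤ N) (hbm : b ≤ m)
    (hb : ∀ ζ ∉ S, b ≤ E.meanPosition pEmpty pOcc m ζ) (n : ℕ) :
    ∫ η, quenchedMean pEmpty pOcc n η ∂(E.stationaryLaw ρ) + (b - 2 * m * (2 * n + 1) * N) ≤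
      ∫ η, quenchedMean pEmpty pOcc (n + m) η ∂(E.stationaryLaw ρ) := by
  have hprob : ∑ x ∈ Finset.Icc (-(n : ℤ)) n,
      ∫ η, quenchedProb pEmpty pOcc n x η ∂(E.stationaryLaw ρ) = 1 := by
    rw [← integral_finsetSum _ fun x _ => ?_]
    · simp only [sum_quenchedProb, integral_const, probReal_univ, smul_eq_mul, mul_one]
    · simpa using integrable_quenchedProb_mul (pEmpty := pEmpty) (pOcc := pOcc)
        (E.stationaryLaw ρ) n x (measurable_const (a := (1 : ℝ))) (c := 1) (by simp)
  have hcard : ((Finset.Icc (-(n : ℤ)) n).card : ℝ) = 2 * n + 1 := by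
    rw [Int.card_Icc, show ((n : ℤ) + 1 - -n).toNat = 2 * n + 1 by omega]
    push_cast
    ring
  have hsum := Finset.sum_le_sum fun x (_ : x ∈ Finset.Icc (-(n : ℤ)) n) =>
    integral_quenchedProb_mul_meanPosition_ge hM hS hT hρ hSm hN hbm hb n x
  rw [Finset.sum_sub_distrib, ← Finset.mul_sum, hprob, Finset.sum_const, nsmul_eq_mul,
    hcard] at hsum
  rw [(hM.stationaryLaw ρ).integral_quenchedMean_add]
  linarith

lemma integral_quenchedMean_mul_ge (hM : E.MarkovInvariant) (hS : E.Stationary)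
    (hT : E.TranslationInvariant) (hρ : ρ ∈ E.J) (hSm : MeasurableSet S)
    (hN : (E.μ ρ).real S ≤ N) (hbm : b ≤ m)
    (hb : ∀ ζ ∉ S, b ≤ E.meanPosition pEmpty pOcc m ζ) (j : ℕ) :
    j * (b - 2 * m * (2 * (j * m : ℕ) + 1) * N) ≤
      ∫ η, quenchedMean pEmpty pOcc (j * m) η ∂(E.stationaryLaw ρ) := by
  have hN0 : 0 ≤ N := measureReal_nonneg.trans hN
  suffices h : ∀ i ≤ j, i * (b - 2 * m * (2 * (j * m : ℕ) + 1) * N) ≤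
      ∫ η, quenchedMean pEmpty pOcc (i * m) η ∂(E.stationaryLaw ρ) from h j le_rfl
  intro i
  induction i with
  | zero => simp [quenchedMean]
  | succ i ih =>
    intro hi
    have hstep := integral_quenchedMean_add_ge hM hS hT hρ hSm hN hbm hb (i * m)
    have herr : 2 * m * (2 * ((i * m : ℕ) : ℝ) + 1) * N ≤
        2 * m * (2 * ((j * m : ℕ) : ℝ) + 1) * N := by
      have him : i * m ≤ j * m := Nat.mul_le_mul_right m (by omega)
      gcongr
    rw [Nat.succ_mul, Nat.cast_succ, add_mul, one_mul]
    linarith [ih (by omega)]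

lemma integral_quenchedMean_ge (hM : E.MarkovInvariant) (hS : E.Stationary)
    (hT : E.TranslationInvariant) (hρ : ρ ∈ E.J) (hSm : MeasurableSet S)
    (hN : (E.μ ρ).real S ≤ N) (hm : 0 < m) (hbm : b ≤ m)
    (hb : ∀ ζ ∉ S, b ≤ E.meanPosition pEmpty pOcc m ζ) (M : ℕ) :
    (M / m : ℕ) * (b - 2 * m * (2 * M + 1) * N) - m ≤
      ∫ η, quenchedMean pEmpty pOcc M η ∂(E.stationaryLaw ρ) := by
  have hN0 : 0 ≤ N := measureReal_nonneg.trans hN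
  have hblocks := integral_quenchedMean_mul_ge hM hS hT hρ hSm hN hbm hb (M / m)
  have hrest : ∫ η, quenchedMean pEmpty pOcc (M / m * m) η ∂(E.stationaryLaw ρ) - m ≤
      ∫ η, quenchedMean pEmpty pOcc M η ∂(E.stationaryLaw ρ) := by
    have hadd := integral_quenchedMean_add_ge hM hS hT hρ (N := 0) MeasurableSet.empty (by simp)
      (neg_le_self (Nat.cast_nonneg (α := ℝ) (M % m)))
      (fun ζ _ => (abs_le.1 (abs_meanPosition_le (pEmpty := pEmpty) (pOcc := pOcc) (M % m) ζ)).1)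
      (M / m * m)
    rw [Nat.div_add_mod'] at hadd
    have hmod : ((M % m : ℕ) : ℝ) ≤ m := by exact_mod_cast (Nat.mod_lt M hm).le
    linarith
  have herr : (M / m : ℕ) * (b - 2 * m * (2 * M + 1) * N) ≤
      (M / m : ℕ) * (b - 2 * m * (2 * (M / m * m : ℕ) + 1) * N) := by
    have hle := Nat.div_mul_le_self M m
    gcongr
  linarith

end blocks

end RandomEnvironment

lemma le_div_add_of_blocks_le {v a R : ℝ} {L t M : ℕ} (hL : 0 < L) (htL : t ≤ L) (hLM : L ^ 2 ≤ M)
    (hv : |v| ≤ 1) (hR : 0 ≤ R)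
    (h : (M / (t + L) : ℕ) * (L * v - t - R) - (t + L : ℕ) ≤ a) :
    v ≤ a / M + (4 + 2 * t + R) / L := by
  set j := M / (t + L)
  have hL' : (0 : ℝ) < L := by exact_mod_cast hL
  have hLM' : (L : ℝ) ^ 2 ≤ M := by exact_mod_cast hLM
  have hM' : (0 : ℝ) < M := lt_of_lt_of_le (by positivity) hLM'
  have htL' : (t : ℝ) ≤ L := by exact_mod_cast htL
  have hj : (j : ℝ) * (t + L) ≤ M := by exact_mod_cast Nat.div_mul_le_self M (t + L)
  have hrest : (M : ℝ) - j * (t + L) ≤ t + L := by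
    have := (Nat.lt_div_mul_add (a := M) (b := t + L) (by omega)).le
    rw [sub_le_iff_le_add']
    exact_mod_cast this
  have hjt : (0 : ℝ) ≤ j * t := by positivity
  have hv1 : v ≤ 1 := (abs_le.1 hv).2
  have hMv : M * v ≤ a + j * (2 * t + R) + 2 * (t + L) := by
    have hv_rest : (M - j * (t + L)) * v ≤ t + L :=
      (mul_le_of_le_one_right (sub_nonneg.2 hj) hv1).trans hrest
    have hv_delay : j * t * v ≤ j * t := mul_le_of_le_one_right hjt hv1
    push_cast at h
    linarith
  have hjR : j * (2 * t + R) ≤ M * (2 * t + R) / L := by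
    rw [le_div_iff₀ hL', mul_right_comm]
    gcongr
    linarith
  have hend : 2 * ((t : ℝ) + L) ≤ 4 * M / L := by
    rw [le_div_iff₀ hL']
    nlinarith
  calc v = M * v / M := by field_simp
    _ ≤ (a + M * (2 * t + R) / L + 4 * M / L) / M := by
        gcongr
        linarith
    _ = a / M + (4 + 2 * t + R) / L := by
        field_simp
        ring

lemma block_error_le {K L M N e : ℝ} (hL : 0 < L) (hK : K ≤ 2 * L) (hM : 1 ≤ M) (hN : 0 ≤ N) :
    (2 * L * e + 2 * K * (2 * M + 1) * N) / L ≤ 2 * e + 12 * M * N :=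
  calc _ ≤ (2 * L * e + 2 * (2 * L) * (3 * M) * N) / L := by
        gcongr
        linarith
    _ = 2 * e + 12 * M * N := by
        field_simp
        ring

namespace RandomEnvironment

section speed

variable {T : Type*} [CommSemiring T] [LinearOrder T] [IsStrictOrderedRing T] [Sub T]
  [OrderedSub T] [FloorSemiring T] {E : RandomEnvironment T} {pEmpty pOcc : ℝ}

/-- Cut `[0, M)` into blocks of length `t + L`. In each of them, the first `t` steps are used to
cover an environment of density `ρ` by the one of density `ρ'`, and the walk then keeps up with the
one in the former environment for `L` steps. -/
lemma rangeSpeed_le_rangeSpeed_add (hp : pEmpty ≤ pOcc) (hM : E.MarkovInvariant)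
    (hS : E.Stationary) (hT : E.TranslationInvariant) {ν : ℝ} (hν : E.NoDriftFromSide ν)
    {ρ ρ' r q N : ℝ} (hρ : ρ ∈ E.J) (hρ' : ρ' ∈ E.J) (hq : 0 ≤ q) {t L M H : ℕ}
    (hL : 0 < L) (htL : t ≤ L) (hLM : L ^ 2 ≤ M) {A A' : Set Config} (hA : MeasurableSet A)
    (hA' : MeasurableSet A') (hN : (E.μ ρ).real A ≤ N) (hN' : (E.μ ρ').real A' ≤ N)
    (hcov : ∀ ζ ∉ A', ∀ ζ' ∉ A, E.CoversWithin (t : T) r q ζ ζ')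
    (hH : L + 2 * ν * L ≤ (H : ℝ)) (hr : t + H ≤ r) :
    E.rangeSpeed pEmpty pOcc ρ L ≤ E.rangeSpeed pEmpty pOcc ρ' M +
      ((4 + 2 * t) / L + 40 * Real.exp (-(ν * L) / 4) + 2 * q + 14 * M * N) := by
  set v := E.rangeSpeed pEmpty pOcc ρ L with hv
  set e := 20 * Real.exp (-(ν * L) / 4) + q + N
  have hL' : (0 : ℝ) < L := by exact_mod_cast hL
  have hN0 : 0 ≤ N := measureReal_nonneg.trans hN
  have hvL : L * v = ∫ ξ, E.meanPosition pEmpty pOcc L ξ ∂(E.μ ρ) := by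
    rw [hv, rangeSpeed_eq]
    field_simp
  have hblock : ∀ ζ ∉ A', L * v - t - 2 * L * e ≤ E.meanPosition pEmpty pOcc (t + L) ζ := by
    intro ζ hζ
    have := integral_meanPosition_le_of_coversWithin hp hM hS hT hν hρ hq hA (hcov ζ hζ) hH hr hN
    linarith
  have hblock_le : L * v - t - 2 * L * e ≤ ((t + L : ℕ) : ℝ) := by
    have hle := mul_le_of_le_one_right hL'.le
      (abs_le.1 (abs_rangeSpeed_le (E := E) (pEmpty := pEmpty) (pOcc := pOcc) ρ L)).2
    have hLe : 0 ≤ 2 * L * e := by positivity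
    push_cast
    linarith [Nat.cast_nonneg (α := ℝ) t]
  have hsum := integral_quenchedMean_ge hM hS hT hρ' hA' hN' (by omega) hblock_le hblock M
  rw [sub_sub _ (2 * L * e)] at hsum
  have hdiv := le_div_add_of_blocks_le hL htL hLM (abs_rangeSpeed_le ρ L) (by positivity) hsum
  rw [integral_quenchedMean_stationaryLaw, ← rangeSpeed_eq] at hdiv
  have hM1 : (1 : ℝ) ≤ M := by exact_mod_cast (Nat.one_le_pow 2 L hL).trans hLM
  have herr : (2 * L * e + 2 * ((t + L : ℕ) : ℝ) * (2 * M + 1) * N) / L ≤ 2 * e + 12 * M * N :=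
    block_error_le hL' (by exact_mod_cast (by omega : t + L ≤ 2 * L)) hM1 hN0
  have he : 2 * e ≤ 40 * Real.exp (-(ν * L) / 4) + 2 * q + 2 * M * N := by
    linarith [le_mul_of_one_le_left hN0 hM1]
  rw [add_div] at hdiv
  linarith

end speed

end RandomEnvironment

/-! ### Comparison of two scales -/

section estimates

lemma eventually_pow_mul_exp_neg_le (A : ℝ) {κ : ℝ} (hκ : 0 < κ) (k : ℕ) :
    ∀ᶠ t : ℕ in atTop, A * (t : ℝ) ^ k * Real.exp (-κ * (t : ℝ) ^ (1 / 8 : ℝ)) ≤ (t : ℝ)⁻¹ := by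
  have hroot : Tendsto (fun t : ℕ => (t : ℝ) ^ (1 / 8 : ℝ)) atTop atTop :=
    (tendsto_rpow_atTop (by norm_num)).comp tendsto_natCast_atTop_atTop
  have hlim := ((tendsto_rpow_mul_exp_neg_mul_atTop_nhds_zero ((8 * (k + 1) : ℕ) : ℝ) κ hκ).comp
    hroot).const_mul A
  rw [mul_zero] at hlim
  filter_upwards [hlim.eventually (gt_mem_nhds zero_lt_one), eventually_gt_atTop 0] with t ht ht0
  have ht' : (0 : ℝ) < t := by exact_mod_cast ht0
  have hpow : ((t : ℝ) ^ (1 / 8 : ℝ)) ^ ((8 * (k + 1) : ℕ) : ℝ) = (t : ℝ) ^ k * t := by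
    rw [← Real.rpow_mul ht'.le, ← pow_succ, ← Real.rpow_natCast]
    congr 1
    push_cast
    ring
  simp only [Function.comp_apply, hpow] at ht
  rw [← one_div, le_div_iff₀ ht']
  calc _ = A * ((t : ℝ) ^ k * t * Real.exp (-κ * (t : ℝ) ^ (1 / 8 : ℝ))) := by ring
    _ ≤ 1 := ht.le

lemma eventually_log_cube_lt (A : ℝ) {ν : ℝ} (hν : 0 < ν) :
    ∀ᶠ t : ℕ in atTop, A * (1 + |Real.log (ν * t) ^ 3|) < ν * (t : ℝ) ^ (1 / 8 : ℝ) := by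
  have hone : (fun _ : ℝ => (1 : ℝ)) =o[atTop] fun x : ℝ => x ^ (1 / 8 : ℝ) :=
    Asymptotics.isLittleO_const_left.2
      (.inr (tendsto_norm_atTop_atTop.comp (tendsto_rpow_atTop (by norm_num))))
  have hlog : (fun x : ℝ => Real.log x ^ 3) =o[atTop] fun x : ℝ => x ^ (1 / 8 : ℝ) := by
    simpa using isLittleO_log_rpow_rpow_atTop (3 : ℝ) (s := 1 / 8) (by norm_num)
  have hscale : (fun t : ℕ => (ν * (t : ℝ)) ^ (1 / 8 : ℝ)) =O[atTop]
      fun t : ℕ => ν * (t : ℝ) ^ (1 / 8 : ℝ) := by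
    simp only [Real.mul_rpow hν.le (Nat.cast_nonneg _)]
    exact (Asymptotics.isBigO_refl _ _).const_mul_left _ |>.const_mul_right hν.ne'
  have hlittle := ((((hone.add hlog.abs_left).comp_tendsto
    (tendsto_natCast_atTop_atTop.const_mul_atTop hν)).trans_isBigO hscale).const_mul_left A).bound
      (half_pos one_pos)
  filter_upwards [hlittle, eventually_gt_atTop 0] with t ht ht0
  have hpos : 0 < ν * (t : ℝ) ^ (1 / 8 : ℝ) := by positivity
  rw [Real.norm_of_nonneg hpos.le] at ht
  exact ((Real.le_norm_self _).trans ht).trans_lt (by linarith)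

lemma eventually_mul_inv_le_rpow (A : ℝ) :
    ∀ᶠ t : ℕ in atTop, A * (t : ℝ)⁻¹ ≤ (t : ℝ) ^ (-(1 / 16) : ℝ) / 2 := by
  have hlim := (tendsto_natCast_rpow_neg (y := 15 / 16) (by norm_num)).const_mul A
  rw [mul_zero] at hlim
  filter_upwards [hlim.eventually (gt_mem_nhds (show (0 : ℝ) < 1 / 2 by norm_num)),
    eventually_gt_atTop 0] with t ht ht0
  have ht' : (0 : ℝ) < t := by exact_mod_cast ht0
  have hinv : (t : ℝ)⁻¹ = (t : ℝ) ^ (-(15 / 16) : ℝ) * (t : ℝ) ^ (-(1 / 16) : ℝ) := by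
    rw [← Real.rpow_add ht', ← Real.rpow_neg_one]
    norm_num
  rw [hinv, ← mul_assoc]
  nlinarith [Real.rpow_pos_of_pos ht' (-(1 / 16) : ℝ)]

lemma half_rpow_le_rpow {t L : ℝ} (ht : 0 < t) (hL : 0 < L) (h : L ≤ 4 * t ^ 2) :
    t ^ (-(1 / 16) : ℝ) / 2 ≤ L ^ (-(1 / 32) : ℝ) := by
  have hsq : (t ^ 2) ^ (-(1 / 32) : ℝ) = t ^ (-(1 / 16) : ℝ) := by
    rw [← Real.rpow_natCast, ← Real.rpow_mul ht.le]
    norm_num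
  have hhalf : (1 / 2 : ℝ) ≤ (4 : ℝ) ^ (-(1 / 32) : ℝ) :=
    calc (1 / 2 : ℝ) = (4 : ℝ) ^ (-(1 / 2) : ℝ) := by
          rw [show (4 : ℝ) = 2 ^ (2 : ℝ) by norm_num, ← Real.rpow_mul (by norm_num)]
          norm_num [Real.rpow_neg_one]
      _ ≤ _ := Real.rpow_le_rpow_of_exponent_le (by norm_num) (by norm_num)
  calc t ^ (-(1 / 16) : ℝ) / 2 = 1 / 2 * t ^ (-(1 / 16) : ℝ) := by ring
    _ ≤ 4 ^ (-(1 / 32) : ℝ) * (t ^ 2) ^ (-(1 / 32) : ℝ) := by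
        rw [hsq]
        gcongr
    _ = (4 * t ^ 2) ^ (-(1 / 32) : ℝ) := (Real.mul_rpow (by norm_num) (by positivity)).symm
    _ ≤ L ^ (-(1 / 32) : ℝ) := Real.rpow_le_rpow_of_nonpos hL h (by norm_num)

lemma one_le_mul_sq_mul_rpow {t δ : ℝ} (ht : 0 < t) (h : t ^ (-(1 / 16) : ℝ) / 2 ≤ δ) :
    1 ≤ 4 * δ ^ 2 * t ^ (1 / 8 : ℝ) :=
  calc 1 = (t ^ (-(1 / 16) : ℝ)) ^ 2 * t ^ (1 / 8 : ℝ) := by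
        rw [← Real.rpow_natCast, ← Real.rpow_mul ht.le, ← Real.rpow_add ht]
        norm_num
    _ ≤ (2 * δ) ^ 2 * t ^ (1 / 8 : ℝ) := by
        gcongr
        linarith
    _ = 4 * δ ^ 2 * t ^ (1 / 8 : ℝ) := by ring

lemma rpow_quarter_eq_sq {t : ℝ} (ht : 0 ≤ t) :
    t ^ (1 / 4 : ℝ) = (t ^ (1 / 8 : ℝ)) ^ 2 := by
  rw [Real.rpow_pow_comm ht, ← Real.rpow_natCast, ← Real.rpow_mul ht]
  norm_num

lemma rpow_quarter_le_two_mul_floor {t : ℝ} (ht : 16 ≤ t) :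
    t ^ (1 / 4 : ℝ) ≤ 2 * (⌊t ^ (1 / 4 : ℝ)⌋₊ : ℝ) := by
  have htwo : 2 ≤ t ^ (1 / 4 : ℝ) :=
    calc (2 : ℝ) = 16 ^ (1 / 4 : ℝ) := by
          rw [show (16 : ℝ) = 2 ^ (4 : ℝ) by norm_num, ← Real.rpow_mul (by norm_num)]
          norm_num
      _ ≤ _ := Real.rpow_le_rpow (by norm_num) ht (by norm_num)
  linarith [Nat.lt_floor_add_one (t ^ (1 / 4 : ℝ))]

lemma exp_neg_mul_sq_le {κ δ w x : ℝ} (hκ : 0 < κ) (hw : 0 < w) (h : 1 ≤ 4 * δ ^ 2 * w)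
    (hx : w ^ 2 ≤ x) : Real.exp (-κ * δ ^ 2 * x) ≤ Real.exp (-(κ / 4) * w) := by
  rw [Real.exp_le_exp]
  have hδ := mul_le_mul_of_nonneg_left h (mul_pos hκ hw).le
  have hδx := mul_le_mul_of_nonneg_left hx (mul_nonneg hκ.le (sq_nonneg δ))
  nlinarith

lemma scale_error_le {ν t L M : ℝ} (hν : 0 ≤ ν) (ht : 1 ≤ t) (htL : t ^ 2 ≤ L) (hM : 0 < M)
    (hdrift : 40 * Real.exp (-(ν / 4) * t ^ (1 / 8 : ℝ)) ≤ t⁻¹) :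
    (4 + 2 * t) / L + 40 * Real.exp (-(ν * L) / 4) + 2 * t⁻¹ + 14 * M * (t⁻¹ / M) ≤ 23 * t⁻¹ := by
  have hdelay : (4 + 2 * t) / L ≤ 6 * t⁻¹ :=
    calc (4 + 2 * t) / L ≤ (4 * t + 2 * t) / t ^ 2 := by
          gcongr
          linarith
      _ = 6 * t⁻¹ := by
          field_simp
          norm_num
  have hexp : 40 * Real.exp (-(ν * L) / 4) ≤ t⁻¹ := by
    refine le_trans ?_ hdrift
    have hroot : t ^ (1 / 8 : ℝ) ≤ L :=
      (Real.rpow_le_rpow_of_exponent_le ht (by norm_num : (1 / 8 : ℝ) ≤ (2 : ℕ))).trans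
        ((Real.rpow_natCast t 2).trans_le htL)
    gcongr
    linarith [mul_le_mul_of_nonneg_left hroot hν]
  have hbad : 14 * M * (t⁻¹ / M) = 14 * t⁻¹ := by field_simp
  linarith

end estimates

namespace RandomEnvironment

section typical

variable {T : Type*} [CommSemiring T] [LinearOrder T] {E : RandomEnvironment T}

lemma DensityAtStationarity.eventually_mul_measureReal_compl_typicalSet_le
    (hD : E.DensityAtStationarity) (hM : E.MarkovInvariant) (hT : E.TranslationInvariant) (h : ℕ) :
    ∀ᶠ t : ℕ in atTop, ∀ H M : ℕ, (H : ℝ) ≤ h * t ^ 2 → (M : ℝ) ≤ 256 * t ^ 8 →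
      ∀ δ ∈ Set.Ioo (0 : ℝ) 1, 1 ≤ 4 * δ ^ 2 * (t : ℝ) ^ (1 / 8 : ℝ) → ∀ ρ ∈ E.J,
        M * (E.μ ρ).real (typicalSet H ⌊(t : ℝ) ^ (1 / 4 : ℝ)⌋₊ ρ (δ / 4))ᶜ ≤ (t : ℝ)⁻¹ := by
  obtain ⟨c, hc, hdev⟩ := hD.exists_measureReal_compl_typicalSet_le hM hT
  filter_upwards [eventually_pow_mul_exp_neg_le (512 * (2 * h + 1) ^ 2) (κ := c / 384)
    (by positivity) 12, eventually_ge_atTop 16] with t ht ht16 H M hH hM δ hδ hδw ρ hρ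
  have ht16' : (16 : ℝ) ≤ t := by exact_mod_cast ht16
  set w := (t : ℝ) ^ (1 / 8 : ℝ)
  set l := ⌊(t : ℝ) ^ (1 / 4 : ℝ)⌋₊
  have hexp : Real.exp (-c * (δ / 4) ^ 2 * (l / 3)) ≤ Real.exp (-(c / 384) * w) := by
    have hlw : w ^ 2 ≤ 2 * l :=
      (rpow_quarter_eq_sq (by positivity)).ge.trans (rpow_quarter_le_two_mul_floor ht16')
    convert exp_neg_mul_sq_le (κ := c / 96) (by positivity) (by positivity) hδw hlw using 2 <;> ring
  have hwidth : 2 * (H : ℝ) + 1 ≤ (2 * h + 1) * t ^ 2 := by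
    nlinarith [one_le_pow₀ (n := 2) (by linarith : (1 : ℝ) ≤ t)]
  calc M * (E.μ ρ).real (typicalSet H l ρ (δ / 4))ᶜ
      ≤ M * ((2 * H + 1) ^ 2 * (2 * Real.exp (-c * (δ / 4) ^ 2 * (l / 3)))) := by
        gcongr
        exact hdev ρ hρ (δ / 4) ⟨by linarith [hδ.1], by linarith [hδ.2]⟩ H l
    _ ≤ 256 * t ^ 8 * (((2 * h + 1) * t ^ 2) ^ 2 * (2 * Real.exp (-(c / 384) * w))) := by gcongr
    _ = 512 * (2 * h + 1) ^ 2 * t ^ 12 * Real.exp (-(c / 384) * w) := by ring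
    _ ≤ (t : ℝ)⁻¹ := ht

end typical

section covering

variable {T : Type*} [CommSemiring T] {E : RandomEnvironment T} {ν : ℝ}

lemma Covering.exists_coversWithin_of_mem_typicalSet (h : E.Covering ν) :
    ∃ C C' : ℝ, 0 < C ∧ 0 < C' ∧ ∀ ρ ∈ E.J, ∀ δ ∈ Set.Ioo (0 : ℝ) 1, ρ + δ ∈ E.J →
      ∀ H t : ℕ, 1 ≤ H → 1 ≤ t → 4 * ν * t < H → 1 < ν ^ 8 * t →
      C * δ⁻¹ ^ 2 * (1 + |Real.log (ν * t) ^ 3|) < ν * (t : ℝ) ^ (1 / 4 : ℝ) →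
      ∀ ζ ∈ typicalSet H ⌊(t : ℝ) ^ (1 / 4 : ℝ)⌋₊ (ρ + δ) (δ / 4),
      ∀ ζ' ∈ typicalSet H ⌊(t : ℝ) ^ (1 / 4 : ℝ)⌋₊ ρ (δ / 4),
        E.CoversWithin (t : T) (H - 4 * ν * t)
          (C' * t * H * Real.exp (-(C' * (1 + ν⁻¹))⁻¹ * δ ^ 2 * (t : ℝ) ^ (1 / 4 : ℝ))) ζ ζ' := by
  obtain ⟨C, C', hC, hC', hcov⟩ := h
  refine ⟨C, C', hC, hC', fun ρ hρ δ hδ hρδ H t hH ht hνt hν8 hlog ζ hζ ζ' hζ' => ?_⟩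
  obtain ⟨Q, hQ, hG⟩ := hcov ρ hρ δ hδ hρδ H t hH ht hνt hν8 hlog _ rfl ζ ζ'
    fun a b ha hab hb hl hl' =>
      ⟨by linarith [(abs_lt.1 (notMem_deviationSet.1 (hζ a b ha hab hb hl hl'))).1],
        by linarith [(abs_lt.1 (notMem_deviationSet.1 (hζ' a b ha hab hb hl hl'))).2]⟩
  have := hQ.isProbabilityMeasure
  refine ⟨Q, hQ, hG.trans (measureReal_mono fun p hp x hx => ?_)⟩
  exact hp x (by linarith [neg_le_of_abs_le hx]) (le_of_abs_le hx)

lemma Covering.eventually_coversWithin (hC : E.Covering ν) (hν : 0 < ν) (h : ℕ) :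
    ∀ᶠ t : ℕ in atTop, ∀ H : ℕ, 4 * ν * t < H → (H : ℝ) ≤ h * t ^ 2 →
      ∀ δ ∈ Set.Ioo (0 : ℝ) 1, 1 ≤ 4 * δ ^ 2 * (t : ℝ) ^ (1 / 8 : ℝ) →
      ∀ ρ ∈ E.J, ρ + δ ∈ E.J →
      ∀ ζ ∈ typicalSet H ⌊(t : ℝ) ^ (1 / 4 : ℝ)⌋₊ (ρ + δ) (δ / 4),
      ∀ ζ' ∈ typicalSet H ⌊(t : ℝ) ^ (1 / 4 : ℝ)⌋₊ ρ (δ / 4),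
        E.CoversWithin (t : T) (H - 4 * ν * t) (t : ℝ)⁻¹ ζ ζ' := by
  obtain ⟨C, C', hC, hC', hcov⟩ := hC.exists_coversWithin_of_mem_typicalSet
  set κ := (C' * (1 + ν⁻¹))⁻¹
  have hκ : 0 < κ := by positivity
  filter_upwards [eventually_pow_mul_exp_neg_le (C' * h) (κ := κ / 4) (by positivity) 3,
    eventually_log_cube_lt (4 * C) hν, eventually_ge_atTop 1,
    (tendsto_natCast_atTop_atTop.const_mul_atTop (pow_pos hν 8)).eventually_gt_atTop 1]
    with t herr hlog ht hν8 H hνt hH δ hδ hδw ρ hρ hρδ ζ hζ ζ' hζ'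
  have ht' : (0 : ℝ) < t := by exact_mod_cast ht
  have hδ0 := hδ.1
  have hw2 := rpow_quarter_eq_sq ht'.le
  set w := (t : ℝ) ^ (1 / 8 : ℝ)
  have hH1 : 1 ≤ H := by exact_mod_cast (by positivity : 0 < 4 * ν * t).trans hνt
  have hlog' : C * δ⁻¹ ^ 2 * (1 + |Real.log (ν * t) ^ 3|) < ν * (t : ℝ) ^ (1 / 4 : ℝ) := by
    have hinv : δ⁻¹ ^ 2 ≤ 4 * w := by
      rw [inv_pow, inv_le_iff_one_le_mul₀ (by positivity)]
      linarith
    calc C * δ⁻¹ ^ 2 * (1 + |Real.log (ν * t) ^ 3|)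
        ≤ C * (4 * w) * (1 + |Real.log (ν * t) ^ 3|) := by gcongr
      _ = 4 * C * (1 + |Real.log (ν * t) ^ 3|) * w := by ring
      _ < ν * w * w := mul_lt_mul_of_pos_right hlog (by positivity)
      _ = ν * (t : ℝ) ^ (1 / 4 : ℝ) := by rw [hw2]; ring
  refine (hcov ρ hρ δ hδ hρδ H t hH1 ht hνt hν8 hlog' ζ hζ ζ' hζ').mono ?_
  have hexp : Real.exp (-κ * δ ^ 2 * (t : ℝ) ^ (1 / 4 : ℝ)) ≤ Real.exp (-(κ / 4) * w) :=
    exp_neg_mul_sq_le hκ (by positivity) hδw hw2.ge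
  calc C' * t * H * Real.exp (-κ * δ ^ 2 * (t : ℝ) ^ (1 / 4 : ℝ))
      ≤ C' * t * (h * t ^ 2) * Real.exp (-(κ / 4) * w) := by gcongr
    _ = C' * h * t ^ 3 * Real.exp (-(κ / 4) * w) := by ring
    _ ≤ (t : ℝ)⁻¹ := herr

end covering

section scales

variable {T : Type*} [CommSemiring T] [LinearOrder T] [IsStrictOrderedRing T] [Sub T]
  [OrderedSub T] [FloorSemiring T] {E : RandomEnvironment T} {pEmpty pOcc : ℝ}

lemma eventually_rangeSpeed_le_add (hp : pEmpty ≤ pOcc) (hM : E.MarkovInvariant)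
    (hS : E.Stationary) (hT : E.TranslationInvariant) (hD : E.DensityAtStationarity) {ν : ℝ}
    (hν : 0 < ν) (hN : E.NoDriftFromSide ν) (hC : E.Covering ν) :
    ∀ᶠ t : ℕ in atTop, ∀ L M : ℕ, t ^ 2 ≤ L → L ≤ 4 * t ^ 2 → L ^ 2 ≤ M → M ≤ L ^ 4 →
      ∀ δ ∈ Set.Ioo (0 : ℝ) 1, 1 ≤ 4 * δ ^ 2 * (t : ℝ) ^ (1 / 8 : ℝ) →
      ∀ ρ ∈ E.J, ρ + δ ∈ E.J →
        E.rangeSpeed pEmpty pOcc ρ L ≤ E.rangeSpeed pEmpty pOcc (ρ + δ) M + 23 * (t : ℝ)⁻¹ := by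
  set h₁ := ⌈1 + 2 * ν⌉₊
  set h₂ := ⌈1 + 4 * ν⌉₊
  filter_upwards [hD.eventually_mul_measureReal_compl_typicalSet_le hM hT (4 * (h₁ + h₂)),
    hC.eventually_coversWithin hν (4 * (h₁ + h₂)),
    eventually_pow_mul_exp_neg_le 40 (κ := ν / 4) (by positivity) 0, eventually_ge_atTop 1]
    with t htyp hcov hdrift ht L M htL hLt hLM hML δ hδ hδw ρ hρ hρδ
  have ht' : (1 : ℝ) ≤ t := by exact_mod_cast ht
  have htL' : (t : ℝ) ^ 2 ≤ L := by exact_mod_cast htL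
  have htL₁ : t ≤ L := (Nat.le_self_pow two_ne_zero t).trans htL
  have hL : 0 < L := by omega
  have hM0 : (0 : ℝ) < M := by exact_mod_cast (pow_pos hL 2).trans_le hLM
  have hH : ((h₁ + h₂) * L : ℕ) ≤ ((4 * (h₁ + h₂) : ℕ) : ℝ) * t ^ 2 := by
    exact_mod_cast (by nlinarith : (h₁ + h₂) * L ≤ 4 * (h₁ + h₂) * t ^ 2)
  have hM8 : (M : ℝ) ≤ 256 * t ^ 8 := by
    exact_mod_cast hML.trans ((Nat.pow_le_pow_left hLt 4).trans_eq (by ring))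
  have hwide : (L : ℝ) + 2 * ν * L ≤ (h₁ * L : ℕ) := by
    push_cast
    linarith [mul_le_mul_of_nonneg_right (Nat.le_ceil (1 + 2 * ν)) (Nat.cast_nonneg (α := ℝ) L)]
  have hfar : (t : ℝ) + (h₁ * L : ℕ) ≤ ((h₁ + h₂) * L : ℕ) - 4 * ν * t := by
    have hceil : (1 + 4 * ν) * t ≤ h₂ * L := by
      have := Nat.le_ceil (1 + 4 * ν)
      gcongr
    push_cast
    linarith
  have hprob : ∀ ρ' ∈ E.J, (E.μ ρ').real (typicalSet ((h₁ + h₂) * L)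
      ⌊(t : ℝ) ^ (1 / 4 : ℝ)⌋₊ ρ' (δ / 4))ᶜ ≤ (t : ℝ)⁻¹ / M := fun ρ' hρ' =>
    (le_div_iff₀' hM0).2 (htyp _ M hH hM8 δ hδ hδw ρ' hρ')
  have hcompare := rangeSpeed_le_rangeSpeed_add hp hM hS hT hN hρ hρδ (by positivity) hL htL₁ hLM
    (measurableSet_typicalSet _ _ _ _).compl (measurableSet_typicalSet _ _ _ _).compl
    (hprob ρ hρ) (hprob _ hρδ) (fun ζ hζ ζ' hζ' => hcov _ (by linarith) hH δ hδ hδw ρ hρ hρδ ζ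
      (not_not.1 hζ) ζ' (not_not.1 hζ')) hwide hfar
  refine hcompare.trans (add_le_add_right ?_ _)
  exact scale_error_le hν.le ht' htL' hM0 (by simpa using hdrift)

lemma eventually_comparableAtScale (hp : pEmpty ≤ pOcc) (hM : E.MarkovInvariant)
    (hS : E.Stationary) (hT : E.TranslationInvariant) (hD : E.DensityAtStationarity) {ν : ℝ}
    (hν : 0 < ν) (hN : E.NoDriftFromSide ν) (hC : E.Covering ν) :
    ∀ᶠ L in atTop, ComparableAtScale (E.rangeSpeed pEmpty pOcc) E.J L := by
  have hsqrt : Tendsto Nat.sqrt atTop atTop :=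
    tendsto_atTop_atTop.2 fun b => ⟨b ^ 2, fun _ h => Nat.le_sqrt'.2 h⟩
  filter_upwards [hsqrt.eventually (eventually_rangeSpeed_le_add hp hM hS hT hD hν hN hC),
    hsqrt.eventually (eventually_mul_inv_le_rpow 23), eventually_gt_atTop 0]
    with L hcompare herr hL δ hδ hδ1 ρ hρ hρδ M hLM hML
  have ht : 0 < L.sqrt := Nat.sqrt_pos.2 hL
  have ht' : (0 : ℝ) < L.sqrt := by exact_mod_cast ht
  have hL' : (0 : ℝ) < L := by exact_mod_cast hL
  have hLt : L ≤ 4 * L.sqrt ^ 2 := by nlinarith [Nat.lt_succ_sqrt' L]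
  have hrate := half_rpow_le_rpow ht' hL' (by exact_mod_cast hLt)
  have hδ0 : 0 < δ := (Real.rpow_pos_of_pos hL' _).trans_le hδ
  exact (hcompare L M (Nat.sqrt_le' L) hLt hLM hML δ ⟨hδ0, hδ1⟩
    (one_le_mul_sq_mul_rpow ht' (hrate.trans hδ)) ρ hρ hρδ).trans (by linarith)

end scales

end RandomEnvironment

theorem proposition4p1_general {T : Type*} [CommSemiring T] [LinearOrder T]
    [IsStrictOrderedRing T] [Sub T] [OrderedSub T] [FloorSemiring T]
    (E : RandomEnvironment T) (ν pEmpty pOcc : ℝ) (hν : 0 < ν) (hp : pEmpty ≤ pOcc)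
    (hMarkov : E.MarkovInvariant) (hStat : E.Stationary) (hTrans : E.TranslationInvariant)
    (hDens : E.DensityAtStationarity) (hDrift : E.NoDriftFromSide ν) (hCover : E.Covering ν) :
    (∀ ρ ∈ E.J, ∀ ε : ℝ, 0 < ε → ρ + ε ∈ E.J →
      limsup (fun L : ℕ => E.rangeSpeed pEmpty pOcc ρ L) atTop ≤
        liminf (fun L : ℕ => E.rangeSpeed pEmpty pOcc (ρ + ε) L) atTop) ∧
    (E.J \ E.Jbar pEmpty pOcc).Countable ∧
    MonotoneOn (E.speed pEmpty pOcc) (E.Jbar pEmpty pOcc) := by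
  have hle : ∀ ρ, IsBoundedUnder (· ≤ ·) atTop (E.rangeSpeed pEmpty pOcc ρ) := fun ρ =>
    isBoundedUnder_of ⟨1, fun L => (abs_le.1 (RandomEnvironment.abs_rangeSpeed_le ρ L)).2⟩
  have hge : ∀ ρ, IsBoundedUnder (· ≥ ·) atTop (E.rangeSpeed pEmpty pOcc ρ) := fun ρ =>
    isBoundedUnder_of ⟨-1, fun L => (abs_le.1 (RandomEnvironment.abs_rangeSpeed_le ρ L)).1⟩
  have hlim : ∀ ρ ∈ E.J, ∀ ρ' ∈ E.J, ρ < ρ' → limsup (E.rangeSpeed pEmpty pOcc ρ) atTop ≤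
      liminf (E.rangeSpeed pEmpty pOcc ρ') atTop := fun ρ hρ ρ' hρ' hlt =>
    ComparableAtScale.limsup_le_liminf Set.ordConnected_Ioo hle hge
      (RandomEnvironment.eventually_comparableAtScale hp hMarkov hStat hTrans hDens hν hDrift
        hCover) hρ hρ' hlt
  exact ⟨fun ρ hρ ε hε hρε => hlim ρ hρ _ hρε (lt_add_of_pos_right ρ hε),
    countable_diff_tendsto hle hge hlim, monotoneOn_limUnder hlim⟩

theorem proposition4p1 {T : Type*} [CommSemiring T] [LinearOrder T] [IsStrictOrderedRing T]
    [CanonicallyOrderedAdd T] [Sub T] [OrderedSub T] [FloorSemiring T]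
    (E : RandomEnvironment T) (ν pEmpty pOcc : ℝ) (hν : 0 < ν)
    (hp0 : 0 ≤ pEmpty) (hp : pEmpty < pOcc) (hp1 : pOcc ≤ 1)
    (hMarkov : E.MarkovInvariant) (hStat : E.Stationary) (hTrans : E.TranslationInvariant)
    (hMono : E.Monotonicity) (hDens : E.DensityAtStationarity)
    (hDrift : E.NoDriftFromSide ν) (hCover : E.Covering ν) :
    (∀ ρ ∈ E.J, ∀ ε : ℝ, 0 < ε → ρ + ε ∈ E.J →
      limsup (fun L : ℕ => E.rangeSpeed pEmpty pOcc ρ L) atTop ≤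
        liminf (fun L : ℕ => E.rangeSpeed pEmpty pOcc (ρ + ε) L) atTop) ∧
    (E.J \ E.Jbar pEmpty pOcc).Countable ∧
    MonotoneOn (E.speed pEmpty pOcc) (E.Jbar pEmpty pOcc) := by
  exact proposition4p1_general E ν pEmpty pOcc hν hp.le hMarkov hStat hTrans hDens hDrift hCover
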